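/- **Setting.** Let $n,m\in\mathbb N$. For $i=1,\dots,n$ consider the linear process $x^{(i)}_{k+1}=A_ix^{(i)}_k+w^{(i)}_k$, $y^{(i)}_k=C_ix^{(i)}_k+v^{(i)}_k$ with Gaussian noises $w^{(i)}_k\sim\mathcal N(0,Q_i)$, $v^{(i)}_k\sim\mathcal N(0,R_i)$ and initial state $x^{(i)}_0\sim\mathcal N(0,\Sigma_i)$, where $Q_i,\Sigma_i$ are positive semidefinite, $R_i$ is positive definite, $(A_i,C_i)$ is detectable and $(A_i,\sqrt{Q_i})$ is stabilizable. Put $h_i(X)=A_iXA_i^\top+Q_i$, and let $\overline P^{(i)}$ be the steady-state (limiting) a posteriori error covariance of the Kalman filter of process $i$. Sensor $i$ has packet arrival probability $\lambda_i\in[0,1]$ and transmission cost $c_c^{(i)}\in\mathbb R$. Let $\rho$ denote the spectral radius and assume $\max_i\rho^2(A_i)(1-\lambda_i)<1$. **The MDP.** The states are $s=(\tau^{(1)},\dots,\tau^{(n)})\in\mathbb S=\mathbb N^n$ (times elapsed since the last received packets). The actions are $\mathbb A=\{a\in\{0,1\}^n:\sum_ia^{(i)}\le m\}$ ($m$ is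 the number of channels). The transition law is $\mathtt{Pr}(s_+|s,a)=\prod_{i=1}^n\mathtt{Pr}^{(i)}(\tau_+^{(i)}|\tau^{(i)},a^{(i)})$: if $a^{(i)}=1$, then $\tau^{(i)}_+=0$ with probability $\lambda_i$ and $\tau^{(i)}_+=\tau^{(i)}+1$ with probability $1-\lambda_i$; if $a^{(i)}=0$, then $\tau^{(i)}_+=\tau^{(i)}+1$. The one-stage cost is $c(s,a)=\sum_{i=1}^n\big[\mathrm{Tr}\big(h_i^{\tau^{(i)}}(\overline P^{(i)})\big)+c_c^{(i)}a^{(i)}\big]$. Let $\Pi$ be the set of all history-dependent randomized policies. For $\pi\in\Pi$ and an initial state $s_0$ let $$J(\pi)=J(\pi,s_0)=\limsup_{T\to\infty}\frac1{T+1}\sum_{k=0}^T\mathbb E\big[c(s_k,a_k)\big]\in(-\infty,+\infty].$$ **Algorithm 1.** List the unstable processes (those with $\rho(A_i)\ge1$) in any order, each of them once. Treat them one after the other: put process $i$ into the first of the existing groups $G$ with $\max_{i'\in G\cup\{i\}}\rho^2(A_{i'})\cdot\max_{j'\in G\cup\{i\}}(1-\lambda_{j'})<1$; if there is no such group, open a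 new group $\{i\}$. The output is the number of groups at the end (it is $0$ if there is no unstable process). **Theorem 1.** If the output of Algorithm 1 is at most $m$, then there are a constant $\mathcal J^\star\in\mathbb R$, a function $V^\star:\mathbb S\to\mathbb R$ and a deterministic stationary policy $\pi^\star:\mathbb S\to\mathbb A$ such that for every $s\in\mathbb S$ $$\mathcal J^\star+V^\star(s)=\min_{a\in\mathbb A}\Big[c(s,a)+\sum_{s_+\in\mathbb S}V^\star(s_+)\mathtt{Pr}(s_+|s,a)\Big] =c(s,\pi^\star(s))+\sum_{s_+\in\mathbb S}V^\star(s_+)\mathtt{Pr}(s_+|s,\pi^\star(s)).$$ Moreover, for every initial state, $$J(\pi^\star)=\min_{\pi\in\Pi}J(\pi)=\mathcal J^\star,$$ and under $\pi^\star$ the time-averaged expected costs converge to $\mathcal J^\star$ (the $\limsup$ is a limit). -/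

import Mathlib

open Filter Topology
open scoped MatrixOrder

noncomputable section

namespace SensorScheduling

/-! ### Linear systems -/

/-- The spectral radius of a real square matrix: the largest modulus of its complex eigenvalues
(`0` for the empty matrix). The spectrum is finite, so the supremum is a real number. -/
def specRad {d : ℕ} (A : Matrix (Fin d) (Fin d) ℝ) : ℝ :=
  (spectralRadius ℂ (A.map (algebraMap ℝ ℂ))).toReal

/-- `(A, B)` is stabilizable: some state feedback makes `A + B K` Schur stable. -/
def Stabilizable {d p : ℕ} (A : Matrix (Fin d) (Fin d) ℝ) (B : Matrix (Fin d) (Fin p) ℝ) : Prop :=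
  ∃ K : Matrix (Fin p) (Fin d) ℝ, specRad (A + B * K) < 1

/-- `(A, C)` is detectable: some output injection makes `A + L C` Schur stable. -/
def Detectable {d p : ℕ} (A : Matrix (Fin d) (Fin d) ℝ) (C : Matrix (Fin p) (Fin d) ℝ) : Prop :=
  ∃ L : Matrix (Fin d) (Fin p) ℝ, specRad (A + L * C) < 1

/-- The Lyapunov operator `h(X) = A X Aᵀ + Q`. -/
def lyap {d : ℕ} (A Q X : Matrix (Fin d) (Fin d) ℝ) : Matrix (Fin d) (Fin d) ℝ :=
  A * X * A.transpose + Q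

/-- Measurement update of the Kalman filter: the a posteriori error covariance obtained from the
a priori error covariance `X`. -/
def measUpdate {d p : ℕ} (C : Matrix (Fin p) (Fin d) ℝ) (R : Matrix (Fin p) (Fin p) ℝ)
    (X : Matrix (Fin d) (Fin d) ℝ) : Matrix (Fin d) (Fin d) ℝ :=
  X - X * C.transpose * (C * X * C.transpose + R)⁻¹ * (C * X)

/-- The data of the `n` processes `x⁺ = A x + w`, `y = C x + v` with `w ∼ N(0, Q)`, `v ∼ N(0, R)`,
`x₀ ∼ N(0, S)`, together with the packet arrival rates `lam` and the energy costs `cc` of a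
transmission. -/
structure Network (n : ℕ) where
  dimX : Fin n → ℕ
  dimY : Fin n → ℕ
  A : (i : Fin n) → Matrix (Fin (dimX i)) (Fin (dimX i)) ℝ
  C : (i : Fin n) → Matrix (Fin (dimY i)) (Fin (dimX i)) ℝ
  Q : (i : Fin n) → Matrix (Fin (dimX i)) (Fin (dimX i)) ℝ
  R : (i : Fin n) → Matrix (Fin (dimY i)) (Fin (dimY i)) ℝ
  S : (i : Fin n) → Matrix (Fin (dimX i)) (Fin (dimX i)) ℝ
  lam : Fin n → ℝ
  cc : Fin n → ℝ
  posSemidef_Q : ∀ i, (Q i).PosSemidef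
  posDef_R : ∀ i, (R i).PosDef
  posSemidef_S : ∀ i, (S i).PosSemidef
  detectable : ∀ i, Detectable (A i) (C i)
  stabilizable : ∀ i, Stabilizable (A i) (CFC.sqrt (Q i))
  lam_nonneg : ∀ i, 0 ≤ lam i
  lam_le_one : ∀ i, lam i ≤ 1

namespace Network

variable {n : ℕ}

/-- The a posteriori error covariance of the local Kalman filter of sensor `i` at time `k`. -/
def localCov (N : Network n) (i : Fin n) : ℕ → Matrix (Fin (N.dimX i)) (Fin (N.dimX i)) ℝ
  | 0 => measUpdate (N.C i) (N.R i) (N.S i)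
  | k + 1 => measUpdate (N.C i) (N.R i) (lyap (N.A i) (N.Q i) (localCov N i k))

/-- The steady-state a posteriori error covariance of the local Kalman filter of sensor `i`. -/
def steadyCov (N : Network n) (i : Fin n) : Matrix (Fin (N.dimX i)) (Fin (N.dimX i)) ℝ :=
  limUnder atTop (N.localCov i)

/-- The estimation cost `Tr (hᵗ(P̄))` of process `i` when its last packet was received `t` steps
ago. -/
def estCost (N : Network n) (i : Fin n) (t : ℕ) : ℝ :=
  (((lyap (N.A i) (N.Q i))^[t]) (N.steadyCov i)).trace

/-- The standing necessary condition `max_i ρ²(A_i) (1 - λ_i) < 1`. -/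
def NecessaryCondition (N : Network n) : Prop :=
  ∀ i, specRad (N.A i) ^ 2 * (1 - N.lam i) < 1

/-! ### The grouping algorithm -/

/-- The test of the algorithm: process `i` may join the group `G`. -/
def Fits (N : Network n) (G : Finset (Fin n)) (i : Fin n) : Prop :=
  (insert i G).sup' (Finset.insert_nonempty i G) (fun i' => specRad (N.A i') ^ 2) *
    (insert i G).sup' (Finset.insert_nonempty i G) (fun j' => 1 - N.lam j') < 1

open Classical in
/-- Put process `i` in the first group that it fits; if there is none, open a new group. -/
def place (N : Network n) (i : Fin n) : List (Finset (Fin n)) → List (Finset (Fin n))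
  | [] => [{i}]
  | G :: Gs => if N.Fits G i then insert i G :: Gs else G :: place N i Gs

/-- The groups formed when the processes are treated in the order of the list `Gu`. -/
def groups (N : Network n) (Gu : List (Fin n)) : List (Finset (Fin n)) :=
  Gu.foldl (fun Gs i => N.place i Gs) []

/-- The output of the algorithm: the number of groups. -/
def numGroups (N : Network n) (Gu : List (Fin n)) : ℕ :=
  (N.groups Gu).length

/-- `Gu` lists the unstable processes, each of them once. -/
def EnumeratesUnstable (N : Network n) (Gu : List (Fin n)) : Prop :=
  Gu.Nodup ∧ ∀ i, i ∈ Gu ↔ 1 ≤ specRad (N.A i)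

end Network

/-! ### The Markov decision process -/

/-- States: the times elapsed since the last received packets. -/
abbrev State (n : ℕ) : Type := Fin n → ℕ

/-- Actions: at most `m` of the `n` sensors transmit. -/
abbrev Action (n m : ℕ) : Type := {a : Fin n → Bool // ∑ i, (a i).toNat ≤ m}

/-- Transition probabilities of a single process. -/
def stepProb (lam : ℝ) (t : ℕ) (b : Bool) (t' : ℕ) : ℝ :=
  if t' = 0 ∧ b = true then lam
  else if t' = t + 1 ∧ b = true then 1 - lam
  else if t' = t + 1 ∧ b = false then 1
  else 0

theorem stepProb_nonneg {lam : ℝ} (h0 : 0 ≤ lam) (h1 : lam ≤ 1) (t : ℕ) (b : Bool) (t' : ℕ) :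
    0 ≤ stepProb lam t b t' := by
  unfold stepProb
  split_ifs <;> linarith

theorem sum_stepProb (lam : ℝ) (t : ℕ) (b : Bool) :
    ∑ t' ∈ ({0, t + 1} : Finset ℕ), stepProb lam t b t' = 1 := by
  rw [Finset.sum_pair (by omega)]
  cases b <;> simp [stepProb]

theorem stepProb_eq_zero (lam : ℝ) {t : ℕ} (b : Bool) {t' : ℕ}
    (h : t' ∉ ({0, t + 1} : Finset ℕ)) : stepProb lam t b t' = 0 := by
  simp only [Finset.mem_insert, Finset.mem_singleton, not_or] at h
  simp [stepProb, h.1, h.2]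

namespace Network

variable {n : ℕ}

/-- The transition law `Pr(s' | s, a)`. -/
def transProb (N : Network n) {m : ℕ} (s : State n) (a : Action n m) (s' : State n) : ℝ :=
  ∏ i, stepProb (N.lam i) (s i) (a.1 i) (s' i)

/-- The transition law as a probability mass function. -/
def trans (N : Network n) {m : ℕ} (s : State n) (a : Action n m) : PMF (State n) :=
  PMF.ofFinset (fun s' => ENNReal.ofReal (N.transProb s a s'))
    (Fintype.piFinset fun i => ({0, s i + 1} : Finset ℕ))
    (by
      rw [← ENNReal.ofReal_sum_of_nonneg]
      · unfold transProb
        rw [← Finset.prod_univ_sum (fun i => ({0, s i + 1} : Finset ℕ))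
          (fun i t' => stepProb (N.lam i) (s i) (a.1 i) t')]
        simp only [sum_stepProb, Finset.prod_const_one, ENNReal.ofReal_one]
      · intro s' _
        exact Finset.prod_nonneg fun i _ =>
          stepProb_nonneg (N.lam_nonneg i) (N.lam_le_one i) _ _ _)
    (by
      intro s' hs'
      rw [Fintype.mem_piFinset, not_forall] at hs'
      obtain ⟨i, hi⟩ := hs'
      rw [transProb, Finset.prod_eq_zero (Finset.mem_univ i) (stepProb_eq_zero _ _ hi),
        ENNReal.ofReal_zero])

/-- The one-stage cost. -/
def cost (N : Network n) {m : ℕ} (s : State n) (a : Action n m) : ℝ :=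
  ∑ i, (N.estCost i (s i) + N.cc i * ((a.1 i).toNat : ℝ))

/-- The quantity minimized in the Bellman equation. Only finitely many `s'` have a positive
probability, so the sum is finite. -/
def bellmanValue (N : Network n) {m : ℕ} (V : State n → ℝ) (s : State n) (a : Action n m) : ℝ :=
  N.cost s a + ∑' s', V s' * N.transProb s a s'

end Network

/-- A general policy: it maps the past states and actions `(s₀, a₀), …, (s_{k-1}, a_{k-1})` and the
current state `s_k` to a probability distribution of the action `a_k`. -/
abbrev Policy (n m : ℕ) : Type :=
  (k : ℕ) → (Fin k → State n × Action n m) → State n → PMF (Action n m)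

/-- The policy that uses the deterministic stationary rule `f`. -/
def stationaryPolicy {n m : ℕ} (f : State n → Action n m) : Policy n m :=
  fun _ _ s => PMF.pure (f s)

namespace Network

variable {n m : ℕ}

/-- The law of the history `(s₀, a₀, …, s_{k-1}, a_{k-1}, s_k)` under a policy. -/
def historyLaw (N : Network n) (π : Policy n m) (s₀ : State n) :
    (k : ℕ) → PMF ((Fin k → State n × Action n m) × State n)
  | 0 => PMF.pure (Fin.elim0, s₀)
  | k + 1 => (historyLaw N π s₀ k).bind fun x => (π k x.1 x.2).bind fun a =>
      (N.trans x.2 a).map fun s' => (Fin.snoc x.1 (x.2, a), s')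

/-- The law of `(s_k, a_k)` under a policy. -/
def stageLaw (N : Network n) (π : Policy n m) (s₀ : State n) (k : ℕ) : PMF (State n × Action n m) :=
  (historyLaw N π s₀ k).bind fun x => (π k x.1 x.2).map fun a => (x.2, a)

/-- The expected cost at time `k`. Only finitely many pairs `(s_k, a_k)` have a positive
probability, so the sum is finite. -/
def expectedCost (N : Network n) (π : Policy n m) (s₀ : State n) (k : ℕ) : ℝ :=
  ∑' x : State n × Action n m, (N.stageLaw π s₀ k x).toReal * N.cost x.1 x.2

/-- The time-averaged expected cost up to time `T`. -/
def timeAverage (N : Network n) (π : Policy n m) (s₀ : State n) (T : ℕ) : ℝ :=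
  (1 / ((T : ℝ) + 1)) * ∑ k ∈ Finset.range (T + 1), N.expectedCost π s₀ k

/-- The long-run average cost of a policy from the initial state `s₀`, possibly `+∞`. It is a
limit superior, since the time averages of a general policy need not converge. -/
def averageCost (N : Network n) (π : Policy n m) (s₀ : State n) : EReal :=
  limsup (fun T => ((N.timeAverage π s₀ T : ℝ) : EReal)) atTop

end Network

end SensorScheduling

end

/-! The proof is the vanishing discount method, fed by three facts about the model.

Estimation costs: the Riccati recursion converges, so the steady covariance `P̄` is positive
semidefinite and `h(P̄) ≥ P̄` (`exists_riccati_limit`, `steadyCov_spec`). Hence the cost of a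
process is nonnegative and nondecreasing in its age, grows per step by at most a fixed factor up to
a constant, is bounded if the process is stable, and is `O(γ ^ t)` for every `γ > 1` above the
squared spectral radius.

A good policy: give each group its own channel and let it serve its oldest member. Weigh a process
by `κ ^ rank * γ ^ age`, where the rank counts the other members at least as old. A failed
transmission multiplies the weight by `γ`; the success of another member lowers the rank, hence
multiplies it by at most `γ / κ`; a success of the process itself resets the age. As `γ i * (1 - lam
j) < 1` within a group, the weight contracts for large `κ`, and a combination of weights is a
Lyapunov function (`exists_isLyapunov`). So `(1 - α) V_α` stays bounded as the discount factor `α`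
tends to `1`.

Relative values: all states can be driven by the same channel noise. The transition is then
monotone, so `V_α` is least at `0`. Moreover an extra unit of age persists exactly until its process
is received, and until then its extra cost is dominated, up to a potential, by a multiple of the
cost minus a bound of `(1 - α) V_α(0)`. Summed along an optimal trajectory, this bounds `V_α(s) -
V_α(0)` uniformly in `α` (`discValue_up_le`, `exists_discValue_sub_le`).

Limits along an ultrafilter satisfy the optimality equation with equality, since actions and noise
values are finite in number. An Abelian estimate (`le_of_eventually_totalCost_le`) shows that no
policy beats `J`. The minimizing rule has total cost `T * J + V s₀ - E V(s_T)`, so it attains `J` as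
an upper bound; that its averages converge needs `E V(s_T) = o(T)`, which is the Tauberian estimate
`tendsto_div_of_abel`. -/

namespace SensorScheduling

/-! ### Expectations under finitely supported probability mass functions -/

section Expectation

variable {α β : Type*}

/-- The expectation of a real function under a probability mass function. -/
noncomputable def pmfExp (p : PMF α) (g : α → ℝ) : ℝ := ∑' x, (p x).toReal * g x

theorem pmfExp_eq_sum (p : PMF α) (g : α → ℝ) (s : Finset α) (hs : p.support ⊆ s) :
    pmfExp p g = ∑ x ∈ s, (p x).toReal * g x := by
  refine tsum_eq_sum fun x hx => ?_
  have : p x = 0 := by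
    by_contra h
    exact hx (hs ((p.mem_support_iff x).2 h))
  simp [this]

theorem pmfExp_congr {p : PMF α} {f g : α → ℝ} (h : ∀ x ∈ p.support, f x = g x) :
    pmfExp p f = pmfExp p g := by
  refine tsum_congr fun x => ?_
  by_cases hx : x ∈ p.support
  · rw [h x hx]
  · rw [p.mem_support_iff, not_not] at hx
    simp [hx]

theorem pmfExp_mono {p : PMF α} (hp : p.support.Finite) {f g : α → ℝ} (h : ∀ x, f x ≤ g x) :
    pmfExp p f ≤ pmfExp p g := by
  rw [pmfExp_eq_sum p f hp.toFinset (by simp), pmfExp_eq_sum p g hp.toFinset (by simp)]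
  exact Finset.sum_le_sum fun x _ => mul_le_mul_of_nonneg_left (h x) ENNReal.toReal_nonneg

theorem pmfExp_add {p : PMF α} (hp : p.support.Finite) (f g : α → ℝ) :
    pmfExp p (fun x => f x + g x) = pmfExp p f + pmfExp p g := by
  simp only [pmfExp_eq_sum p _ hp.toFinset (by simp), mul_add, Finset.sum_add_distrib]

theorem pmfExp_const_mul (p : PMF α) (c : ℝ) (f : α → ℝ) :
    pmfExp p (fun x => c * f x) = c * pmfExp p f := by
  simp only [pmfExp, ← tsum_mul_left]
  exact tsum_congr fun x => by ring

theorem pmfExp_const {p : PMF α} (hp : p.support.Finite) (c : ℝ) :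
    pmfExp p (fun _ => c) = c := by
  have h1 : ∑ x ∈ hp.toFinset, p x = 1 := by
    rw [← p.tsum_coe]
    refine (tsum_eq_sum fun x hx => ?_).symm
    simpa using hx
  rw [pmfExp_eq_sum p _ hp.toFinset (by simp), ← Finset.sum_mul,
    ← ENNReal.toReal_sum fun x _ => p.apply_ne_top x, h1, ENNReal.toReal_one, one_mul]

theorem pmfExp_nonneg (p : PMF α) {f : α → ℝ} (h : ∀ x, 0 ≤ f x) : 0 ≤ pmfExp p f :=
  tsum_nonneg fun x => mul_nonneg ENNReal.toReal_nonneg (h x)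

theorem pmfExp_pure (a : α) (f : α → ℝ) : pmfExp (PMF.pure a) f = f a := by
  rw [pmfExp_eq_sum _ _ {a} (by simp)]
  simp

theorem finite_support_bind {p : PMF α} {q : α → PMF β} (hp : p.support.Finite)
    (hq : ∀ x, (q x).support.Finite) : (p.bind q).support.Finite := by
  rw [PMF.support_bind]
  exact hp.biUnion fun x _ => hq x

theorem pmfExp_bind {p : PMF α} {q : α → PMF β} (hp : p.support.Finite)
    (hq : ∀ x, (q x).support.Finite) (g : β → ℝ) :
    pmfExp (p.bind q) g = pmfExp p fun x => pmfExp (q x) g := by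
  have hb := finite_support_bind hp hq
  rw [pmfExp_eq_sum _ g hb.toFinset (by simp), pmfExp_eq_sum p _ hp.toFinset (by simp)]
  have h1 : ∀ x ∈ hp.toFinset, (p x).toReal * pmfExp (q x) g =
      ∑ y ∈ hb.toFinset, (p x).toReal * ((q x y).toReal * g y) := fun x hx => by
    rw [pmfExp_eq_sum (q x) g hb.toFinset, Finset.mul_sum]
    intro y hy
    simp only [Set.Finite.coe_toFinset, PMF.mem_support_bind_iff]
    exact ⟨x, by simpa using hx, hy⟩
  rw [Finset.sum_congr rfl h1, Finset.sum_comm]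
  refine Finset.sum_congr rfl fun y _ => ?_
  have h2 : (p.bind q) y = ∑ x ∈ hp.toFinset, p x * q x y := by
    rw [PMF.bind_apply]
    refine tsum_eq_sum fun x hx => ?_
    have : p x = 0 := by simpa using hx
    simp [this]
  rw [h2, ENNReal.toReal_sum fun x _ =>
    ENNReal.mul_ne_top (p.apply_ne_top x) ((q x).apply_ne_top y), Finset.sum_mul]
  exact Finset.sum_congr rfl fun x _ => by rw [ENNReal.toReal_mul, mul_assoc]

theorem finite_support_map {p : PMF α} (hp : p.support.Finite) (f : α → β) :
    (p.map f).support.Finite := by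
  rw [PMF.support_map]
  exact hp.image f

theorem pmfExp_map {p : PMF α} (hp : p.support.Finite) (f : α → β) (g : β → ℝ) :
    pmfExp (p.map f) g = pmfExp p fun x => g (f x) := by
  rw [← PMF.bind_pure_comp, pmfExp_bind hp fun x => (by simp)]
  simp [pmfExp_pure]

end Expectation

/-! ### The transition law driven by common noise -/

/-- The successor state when the channels with `ω i = true` are up. -/
def next {n m : ℕ} (s : State n) (a : Action n m) (ω : Fin n → Bool) : State n :=
  fun i => if a.1 i = true ∧ ω i = true then 0 else s i + 1

namespace Network

variable {n m : ℕ}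

/-- The probability of the channel states `ω`. -/
def noiseProb (N : Network n) (ω : Fin n → Bool) : ℝ :=
  ∏ i, if ω i = true then N.lam i else 1 - N.lam i

theorem noiseProb_nonneg (N : Network n) (ω : Fin n → Bool) : 0 ≤ N.noiseProb ω :=
  Finset.prod_nonneg fun i _ => by
    split_ifs
    · exact N.lam_nonneg i
    · linarith [N.lam_le_one i]

/-- Independence of the channels: the product of the one-channel expectations, multiplied out. -/
theorem sum_noise_prod (N : Network n) (φ : Fin n → Bool → ℝ) :
    ∑ ω, N.noiseProb ω * ∏ i, φ i (ω i) =
      ∏ i, (N.lam i * φ i true + (1 - N.lam i) * φ i false) := by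
  have h := Finset.prod_univ_sum (fun _ : Fin n => (Finset.univ : Finset Bool))
    (fun i b => (if b = true then N.lam i else 1 - N.lam i) * φ i b)
  simp only [Fintype.univ_bool, Finset.mem_singleton, Bool.true_eq_false, not_false_eq_true,
    Finset.sum_insert, if_true, Finset.sum_singleton, Bool.false_eq_true, if_false] at h
  rw [h]
  simp only [noiseProb, ← Finset.prod_mul_distrib]
  refine Finset.sum_congr ?_ fun _ _ => rfl
  ext ω
  simp

theorem sum_noiseProb (N : Network n) : ∑ ω, N.noiseProb ω = 1 := by
  simpa using N.sum_noise_prod fun _ _ => 1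

theorem sum_noise_coord (N : Network n) (j : Fin n) (φ : Bool → ℝ) :
    ∑ ω, N.noiseProb ω * φ (ω j) = N.lam j * φ true + (1 - N.lam j) * φ false := by
  have h := N.sum_noise_prod fun i b => if i = j then φ b else 1
  simp only [Finset.prod_ite_eq', Finset.mem_univ, if_true] at h
  rw [h, Finset.prod_eq_single j]
  · simp
  · intro i _ hi
    simp [hi]
  · simp

/-- The noise law depends neither on the state nor on the action, so trajectories from different
states can share their noise. Monotonicity and the coupling argument rest on this. -/
theorem transProb_eq_sum (N : Network n) (s : State n) (a : Action n m) (s' : State n) :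
    N.transProb s a s' = ∑ ω, N.noiseProb ω * if next s a ω = s' then 1 else 0 := by
  have h1 : ∀ ω, (if next s a ω = s' then (1 : ℝ) else 0) =
      ∏ i, if (if a.1 i = true ∧ ω i = true then 0 else s i + 1) = s' i then 1 else 0 := fun ω => by
    rw [Finset.prod_boole]
    simp [funext_iff, next]
  simp only [h1]
  rw [N.sum_noise_prod fun i b =>
    if (if a.1 i = true ∧ b = true then 0 else s i + 1) = s' i then 1 else 0, transProb]
  refine Finset.prod_congr rfl fun i _ => ?_
  unfold stepProb
  generalize s' i = t', s i = t, a.1 i = b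
  by_cases h0 : t' = 0
  · subst h0
    cases b <;> simp
  · by_cases h2 : t' = t + 1
    · subst h2
      cases b <;> simp
    · cases b <;> simp [h0, h2, Ne.symm h0, Ne.symm h2]

theorem tsum_transProb (N : Network n) (s : State n) (a : Action n m) (V : State n → ℝ) :
    ∑' s', V s' * N.transProb s a s' = ∑ ω, N.noiseProb ω * V (next s a ω) := by
  simp only [transProb_eq_sum, Finset.mul_sum]
  have h : ∀ ω : Fin n → Bool, HasSum
      (fun s' => V s' * (N.noiseProb ω * if next s a ω = s' then 1 else 0))
      (N.noiseProb ω * V (next s a ω)) := fun ω => by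
    convert! hasSum_ite_eq (next s a ω) (N.noiseProb ω * V (next s a ω)) using 2 with s'
    by_cases h : next s a ω = s'
    · subst h; simp [mul_comm]
    · simp [h, Ne.symm h]
  exact (hasSum_sum fun ω _ => h ω).tsum_eq

theorem transProb_nonneg (N : Network n) (s : State n) (a : Action n m) (s' : State n) :
    0 ≤ N.transProb s a s' :=
  Finset.prod_nonneg fun i _ => stepProb_nonneg (N.lam_nonneg i) (N.lam_le_one i) _ _ _

theorem finite_support_trans (N : Network n) (s : State n) (a : Action n m) :
    (N.trans s a).support.Finite := by
  refine (Fintype.piFinset fun i => ({0, s i + 1} : Finset ℕ)).finite_toSet.subset fun s' h => ?_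
  exact (PMF.mem_support_ofFinset_iff _ _ _).1 h |>.1

theorem pmfExp_trans (N : Network n) (s : State n) (a : Action n m) (V : State n → ℝ) :
    pmfExp (N.trans s a) V = ∑ ω, N.noiseProb ω * V (next s a ω) := by
  rw [← tsum_transProb, pmfExp]
  refine tsum_congr fun s' => ?_
  rw [trans, PMF.ofFinset_apply, ENNReal.toReal_ofReal (N.transProb_nonneg s a s'), mul_comm]

/-! ### Laws of histories -/

theorem finite_support_historyLaw (N : Network n) (π : Policy n m) (s₀ : State n) (k : ℕ) :
    (N.historyLaw π s₀ k).support.Finite := by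
  induction k with
  | zero => simp [historyLaw]
  | succ k ih =>
    exact finite_support_bind ih fun x => finite_support_bind (Set.toFinite _) fun a =>
      finite_support_map (N.finite_support_trans _ _) _

/-- The expectation of a function of the state at time `k`. -/
noncomputable def stateExp (N : Network n) (π : Policy n m) (s₀ : State n) (k : ℕ)
    (V : State n → ℝ) : ℝ :=
  pmfExp (N.historyLaw π s₀ k) fun x => V x.2

theorem stateExp_zero (N : Network n) (π : Policy n m) (s₀ : State n) (V : State n → ℝ) :
    N.stateExp π s₀ 0 V = V s₀ := by
  simp [stateExp, historyLaw, pmfExp_pure]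

theorem stateExp_succ (N : Network n) (π : Policy n m) (s₀ : State n) (k : ℕ) (V : State n → ℝ) :
    N.stateExp π s₀ (k + 1) V = pmfExp (N.historyLaw π s₀ k) fun x => pmfExp (π k x.1 x.2) fun a =>
      ∑ ω, N.noiseProb ω * V (next x.2 a ω) := by
  rw [stateExp, historyLaw, pmfExp_bind (N.finite_support_historyLaw π s₀ k) fun x =>
    finite_support_bind (Set.toFinite _) fun a => finite_support_map (N.finite_support_trans _ _) _]
  refine pmfExp_congr fun x _ => ?_
  rw [pmfExp_bind (Set.toFinite _) fun a => finite_support_map (N.finite_support_trans _ _) _]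
  refine pmfExp_congr fun a _ => ?_
  rw [pmfExp_map (N.finite_support_trans _ _), pmfExp_trans]

theorem expectedCost_eq (N : Network n) (π : Policy n m) (s₀ : State n) (k : ℕ) :
    N.expectedCost π s₀ k = pmfExp (N.historyLaw π s₀ k) fun x =>
      pmfExp (π k x.1 x.2) fun a => N.cost x.2 a := by
  rw [expectedCost, ← pmfExp, stageLaw, pmfExp_bind (N.finite_support_historyLaw π s₀ k) fun x =>
    finite_support_map (Set.toFinite _) _]
  refine pmfExp_congr fun x _ => ?_
  rw [pmfExp_map (Set.toFinite _)]

end Network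

/-! ### Discounted values of Markov decision processes driven by finite noise -/

/-- A Markov decision process with nonnegative costs that is driven by independent noise with
finitely many values. -/
structure NoiseMDP (S A Ω : Type*) [Fintype Ω] where
  prob : Ω → ℝ
  step : S → A → Ω → S
  cost : S → A → ℝ
  prob_nonneg : ∀ ω, 0 ≤ prob ω
  sum_prob : ∑ ω, prob ω = 1
  cost_nonneg : ∀ s a, 0 ≤ cost s a

namespace NoiseMDP

variable {S A Ω : Type*} [Fintype Ω] (M : NoiseMDP S A Ω)

/-- The expected value of `V` at the successor of `s` under the action `a`. -/
noncomputable def nextExp (s : S) (a : A) (V : S → ℝ) : ℝ :=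
  ∑ ω, M.prob ω * V (M.step s a ω)

theorem nextExp_le_of_step {s s' : S} {a : A} {V W : S → ℝ}
    (h : ∀ ω, V (M.step s a ω) ≤ W (M.step s' a ω)) : M.nextExp s a V ≤ M.nextExp s' a W :=
  Finset.sum_le_sum fun ω _ => mul_le_mul_of_nonneg_left (h ω) (M.prob_nonneg ω)

theorem nextExp_mono {s : S} {a : A} {V W : S → ℝ} (h : ∀ s, V s ≤ W s) :
    M.nextExp s a V ≤ M.nextExp s a W :=
  M.nextExp_le_of_step fun _ => h _

theorem nextExp_add (s : S) (a : A) (V W : S → ℝ) :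
    M.nextExp s a (fun x => V x + W x) = M.nextExp s a V + M.nextExp s a W := by
  simp only [nextExp, mul_add, Finset.sum_add_distrib]

theorem nextExp_const_mul (s : S) (a : A) (c : ℝ) (V : S → ℝ) :
    M.nextExp s a (fun x => c * V x) = c * M.nextExp s a V := by
  simp only [nextExp, Finset.mul_sum]
  exact Finset.sum_congr rfl fun _ _ => by ring

theorem nextExp_const (s : S) (a : A) (c : ℝ) : M.nextExp s a (fun _ => c) = c := by
  simp only [nextExp, ← Finset.sum_mul, M.sum_prob, one_mul]

theorem nextExp_nonneg {s : S} {a : A} {V : S → ℝ} (h : ∀ s, 0 ≤ V s) : 0 ≤ M.nextExp s a V :=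
  Finset.sum_nonneg fun ω _ => mul_nonneg (M.prob_nonneg ω) (h _)

theorem tendsto_nextExp {ι : Type*} {l : Filter ι} {V : ι → S → ℝ} {W : S → ℝ}
    (h : ∀ s, Tendsto (fun i => V i s) l (𝓝 (W s))) (s : S) (a : A) :
    Tendsto (fun i => M.nextExp s a (V i)) l (𝓝 (M.nextExp s a W)) :=
  tendsto_finsetSum _ fun _ _ => (h _).const_mul _

variable [Fintype A] [Nonempty A]

/-- The optimal discounted cost over a finite horizon. -/
noncomputable def valueIter (α : ℝ) : ℕ → S → ℝ
  | 0 => fun _ => 0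
  | k + 1 => fun s => Finset.univ.inf' Finset.univ_nonempty fun a =>
      M.cost s a + α * M.nextExp s a (valueIter α k)

theorem valueIter_succ_le (α : ℝ) (k : ℕ) (s : S) (a : A) :
    M.valueIter α (k + 1) s ≤ M.cost s a + α * M.nextExp s a (M.valueIter α k) :=
  Finset.inf'_le _ (Finset.mem_univ a)

theorem valueIter_nonneg {α : ℝ} (hα : 0 ≤ α) (k : ℕ) (s : S) : 0 ≤ M.valueIter α k s := by
  induction k generalizing s with
  | zero => exact le_rfl
  | succ k ih =>
    exact Finset.le_inf' Finset.univ_nonempty _ fun a _ =>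
      add_nonneg (M.cost_nonneg s a) (mul_nonneg hα (M.nextExp_nonneg ih))

theorem valueIter_le_succ {α : ℝ} (hα : 0 ≤ α) (k : ℕ) (s : S) :
    M.valueIter α k s ≤ M.valueIter α (k + 1) s := by
  induction k generalizing s with
  | zero => exact M.valueIter_nonneg hα 1 s
  | succ k ih =>
    refine Finset.le_inf' Finset.univ_nonempty _ fun a _ => (M.valueIter_succ_le α k s a).trans ?_
    gcongr
    exact M.nextExp_mono ih

theorem valueIter_mono {α : ℝ} (hα : 0 ≤ α) (s : S) : Monotone fun k => M.valueIter α k s :=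
  monotone_nat_of_le_succ fun k => M.valueIter_le_succ hα k s

/-- The optimal discounted cost over an infinite horizon. -/
noncomputable def discValue (α : ℝ) (s : S) : ℝ := ⨆ k, M.valueIter α k s

/-- Under common noise the order of two states survives each step, so the larger state can only pay
more for the same action. -/
theorem valueIter_monotone_state [Preorder S]
    (hstep : ∀ s s' a ω, s ≤ s' → M.step s a ω ≤ M.step s' a ω)
    (hcost : ∀ s s' a, s ≤ s' → M.cost s a ≤ M.cost s' a) {α : ℝ} (hα : 0 ≤ α) (k : ℕ)
    {s s' : S} (h : s ≤ s') : M.valueIter α k s ≤ M.valueIter α k s' := by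
  induction k generalizing s s' with
  | zero => exact le_rfl
  | succ k ih =>
    refine Finset.le_inf' Finset.univ_nonempty _ fun a _ => (M.valueIter_succ_le α k s a).trans ?_
    exact add_le_add (hcost s s' a h) (mul_le_mul_of_nonneg_left
      (M.nextExp_le_of_step fun ω => ih (hstep s s' a ω h)) hα)

/-- A Lyapunov function for some stationary rule. -/
def IsLyapunov (W : S → ℝ) (B : ℝ) : Prop :=
  0 ≤ B ∧ (∀ s, 0 ≤ W s) ∧ ∀ s, ∃ a, M.cost s a + M.nextExp s a W ≤ W s + B

variable {M}

namespace IsLyapunov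

variable {W : S → ℝ} {B α : ℝ}

/-- Playing the action of the Lyapunov inequality pays at most the decrease of `W` plus `B` per
step; `B / (1 - α)` is the discounted sum of the latter. -/
theorem valueIter_le (hW : M.IsLyapunov W B) (h0 : 0 ≤ α) (h1 : α < 1) (k : ℕ) (s : S) :
    M.valueIter α k s ≤ W s + B / (1 - α) := by
  obtain ⟨hB, hW0, hW⟩ := hW
  have h2 : 0 < 1 - α := by linarith
  induction k generalizing s with
  | zero => exact add_nonneg (hW0 s) (div_nonneg hB h2.le)
  | succ k ih =>
    obtain ⟨a, ha⟩ := hW s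
    have h3 : M.nextExp s a (M.valueIter α k) ≤ M.nextExp s a W + B / (1 - α) := by
      refine (M.nextExp_mono ih).trans_eq ?_
      rw [M.nextExp_add, M.nextExp_const]
    have h4 := M.valueIter_succ_le α k s a
    have h5 : 0 ≤ M.nextExp s a W := M.nextExp_nonneg hW0
    have h6 : B + α * (B / (1 - α)) = B / (1 - α) := by field_simp; ring
    nlinarith [mul_le_mul_of_nonneg_left h3 h0, mul_nonneg h2.le h5]

theorem bddAbove (hW : M.IsLyapunov W B) (h0 : 0 ≤ α) (h1 : α < 1) (s : S) :
    BddAbove (Set.range fun k => M.valueIter α k s) :=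
  ⟨_, Set.forall_mem_range.2 fun k => hW.valueIter_le h0 h1 k s⟩

theorem valueIter_le_discValue (hW : M.IsLyapunov W B) (h0 : 0 ≤ α) (h1 : α < 1) (k : ℕ) (s : S) :
    M.valueIter α k s ≤ M.discValue α s :=
  le_ciSup (hW.bddAbove h0 h1 s) k

theorem tendsto_valueIter (hW : M.IsLyapunov W B) (h0 : 0 ≤ α) (h1 : α < 1) (s : S) :
    Tendsto (fun k => M.valueIter α k s) atTop (𝓝 (M.discValue α s)) :=
  tendsto_atTop_ciSup (M.valueIter_mono h0 s) (hW.bddAbove h0 h1 s)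

theorem discValue_le (hW : M.IsLyapunov W B) (h0 : 0 ≤ α) (h1 : α < 1) (s : S) :
    M.discValue α s ≤ W s + B / (1 - α) :=
  ciSup_le fun k => hW.valueIter_le h0 h1 k s

theorem discValue_nonneg (hW : M.IsLyapunov W B) (h0 : 0 ≤ α) (h1 : α < 1) (s : S) :
    0 ≤ M.discValue α s :=
  hW.valueIter_le_discValue h0 h1 0 s

/-- Only pointwise convergence of value iteration is needed, because the minimum and the expectation
are both over finite sets. -/
theorem discValue_eq (hW : M.IsLyapunov W B) (h0 : 0 ≤ α) (h1 : α < 1) (s : S) :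
    M.discValue α s = Finset.univ.inf' Finset.univ_nonempty fun a =>
      M.cost s a + α * M.nextExp s a (M.discValue α) := by
  have h2 := (tendsto_add_atTop_iff_nat 1).2 (hW.tendsto_valueIter h0 h1 s)
  refine tendsto_nhds_unique h2 (Tendsto.finset_inf'_nhds_apply _ fun a _ => ?_)
  exact ((M.tendsto_nextExp (fun s => hW.tendsto_valueIter h0 h1 s) s a).const_mul α).const_add _

theorem one_sub_mul_discValue_mem (hW : M.IsLyapunov W B) (h0 : 0 ≤ α) (h1 : α < 1) (s : S) :
    (1 - α) * M.discValue α s ∈ Set.Icc 0 (W s + B) := by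
  have h2 : 0 < 1 - α := by linarith
  refine ⟨mul_nonneg h2.le (hW.discValue_nonneg h0 h1 s), ?_⟩
  have h3 := mul_le_mul_of_nonneg_left (hW.discValue_le h0 h1 s) h2.le
  have h4 : (1 - α) * (W s + B / (1 - α)) = (1 - α) * W s + B := by field_simp
  nlinarith [hW.2.1 s]

theorem discValue_mono [Preorder S] (hW : M.IsLyapunov W B)
    (hstep : ∀ s s' a ω, s ≤ s' → M.step s a ω ≤ M.step s' a ω)
    (hcost : ∀ s s' a, s ≤ s' → M.cost s a ≤ M.cost s' a) (h0 : 0 ≤ α) (h1 : α < 1)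
    {s s' : S} (h : s ≤ s') : M.discValue α s ≤ M.discValue α s' :=
  ciSup_mono (hW.bddAbove h0 h1 s') fun k => M.valueIter_monotone_state hstep hcost h0 k h

/-- Comparison of the discounted values at `z` and at a perturbation `up z`, which a coupled
evolution either preserves or removes. -/
theorem discValue_up_le (hW : M.IsLyapunov W B) (h0 : 0 ≤ α) (h1 : α < 1) {s₀ : S}
    (hs₀ : ∀ s, M.discValue α s₀ ≤ M.discValue α s) {B' : ℝ}
    (hB' : (1 - α) * M.discValue α s₀ ≤ B') {up : S → S} {τ : S → ℕ}
    (hstep : ∀ z a ω, M.step (up z) a ω = M.step z a ω ∨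
      (M.step (up z) a ω = up (M.step z a ω) ∧ τ (M.step z a ω) = τ z + 1))
    {D : ℝ} (hD : 0 ≤ D) {R : ℕ → ℝ} (hR : ∀ k, 0 ≤ R k)
    (hcost : ∀ z a, M.cost (up z) a - M.cost z a + R (τ z + 1) ≤
      D * (M.cost z a - B') + R (τ z)) (z : S) :
    M.discValue α (up z) - M.discValue α s₀ ≤
      (1 + D) * (M.discValue α z - M.discValue α s₀) + R (τ z) := by
  -- Value iteration on the left allows an induction; the limit value on the right has the exact
  -- optimality equation.
  suffices h : ∀ k z, M.valueIter α k (up z) ≤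
      (1 + D) * M.discValue α z + (R (τ z) - D * M.discValue α s₀) by
    have := ciSup_le fun k => h k z
    rw [← discValue] at this
    linarith
  intro k
  induction k with
  | zero =>
    intro z
    have := mul_le_mul_of_nonneg_left (hs₀ z) hD
    simp only [valueIter]
    linarith [hR (τ z), hW.discValue_nonneg h0 h1 z]
  | succ k ih =>
    intro z
    -- The perturbed state imitates an action that is optimal at `z`.
    obtain ⟨a, -, ha⟩ := Finset.exists_mem_eq_inf' Finset.univ_nonempty fun a =>
      M.cost z a + α * M.nextExp z a (M.discValue α)
    rw [← hW.discValue_eq h0 h1] at ha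
    have h2 : M.nextExp (up z) a (M.valueIter α k) ≤
        (1 + D) * M.nextExp z a (M.discValue α) + (R (τ z + 1) - D * M.discValue α s₀) := by
      rw [← M.nextExp_const_mul, ← M.nextExp_const z a (R (τ z + 1) - D * M.discValue α s₀),
        ← M.nextExp_add]
      refine M.nextExp_le_of_step fun ω => ?_
      -- Once the two trajectories have merged, the surplus on the right is `D` times a relative
      -- value, which is nonnegative by `hs₀`, plus a nonnegative potential.
      rcases hstep z a ω with h | ⟨h, h'⟩
      · rw [h]
        have := mul_le_mul_of_nonneg_left (hs₀ (M.step z a ω)) hD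
        linarith [hR (τ z + 1), hW.valueIter_le_discValue h0 h1 k (M.step z a ω)]
      · rw [h, ← h']
        exact ih _
    have h3 := M.valueIter_succ_le α k (up z) a
    have h4 := mul_le_mul_of_nonneg_left h2 h0
    have h5 := hcost z a
    have h6 := mul_le_mul_of_nonneg_left hB' hD
    have h7 : α * R (τ z + 1) ≤ R (τ z + 1) := mul_le_of_le_one_left (hR _) h1.le
    have h8 : (1 + D) * M.discValue α z =
      (1 + D) * (M.cost z a + α * M.nextExp z a (M.discValue α)) := by rw [← ha]
    nlinarith

/-- The vanishing discount argument along an ultrafilter. -/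
theorem exists_tendsto (hW : M.IsLyapunov W B) {U : Ultrafilter ℝ} (hU : ↑U ≤ 𝓝[<] (1 : ℝ))
    {s₀ : S} {K : S → ℝ} (hK : ∀ α, 0 ≤ α → α < 1 → ∀ s,
      M.discValue α s - M.discValue α s₀ ∈ Set.Icc 0 (K s)) :
    ∃ (J : ℝ) (V : S → ℝ), Tendsto (fun α => (1 - α) * M.discValue α s₀) U (𝓝 J) ∧
      (∀ s, Tendsto (fun α => M.discValue α s - M.discValue α s₀) U (𝓝 (V s))) ∧
      (∀ s, 0 ≤ V s) ∧ ∀ s, J + V s = Finset.univ.inf' Finset.univ_nonempty fun a =>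
        M.cost s a + M.nextExp s a V := by
  have hIoo : ∀ᶠ α in (U : Filter ℝ), α ∈ Set.Ioo (0 : ℝ) 1 :=
    hU (Ioo_mem_nhdsLT zero_lt_one)
  -- By compactness every bounded quantity converges along `U`, so no diagonal subsequence over the
  -- states is needed.
  have hlim : ∀ (φ : ℝ → ℝ) (c : ℝ), (∀ α, 0 ≤ α → α < 1 → φ α ∈ Set.Icc 0 c) →
      ∃ x ∈ Set.Icc 0 c, Tendsto φ U (𝓝 x) := fun φ c h => by
    obtain ⟨x, hx, hx'⟩ := (isCompact_Icc (a := (0 : ℝ)) (b := c)).ultrafilter_le_nhds' (U.map φ)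
      (hIoo.mono fun α hα => h α hα.1.le hα.2)
    exact ⟨x, hx, hx'⟩
  obtain ⟨J, -, hJ⟩ := hlim _ _ fun α h0 h1 => hW.one_sub_mul_discValue_mem h0 h1 s₀
  choose V hV hV' using fun s => hlim _ _ fun α h0 h1 => hK α h0 h1 s
  have hid : Tendsto (fun α : ℝ => α) U (𝓝 1) :=
    tendsto_id'.2 (hU.trans nhdsWithin_le_nhds)
  refine ⟨J, V, hJ, hV', fun s => (hV s).1, fun s => ?_⟩
  have h2 : Tendsto (fun α => Finset.univ.inf' Finset.univ_nonempty fun a => M.cost s a +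
      α * M.nextExp s a fun x => M.discValue α x - M.discValue α s₀) U
      (𝓝 (Finset.univ.inf' Finset.univ_nonempty fun a => M.cost s a + 1 * M.nextExp s a V)) :=
    Tendsto.finset_inf'_nhds_apply _ fun a _ =>
      (hid.mul (M.tendsto_nextExp hV' s a)).const_add _
  simp only [one_mul] at h2
  refine tendsto_nhds_unique ((hJ.add (hV' s)).congr' ?_) h2
  -- Subtracting `α * V_α(s₀)` from the discounted equation leaves `(1 - α) V_α(s₀)` on the left.
  -- The two inequalities test each minimum at the minimizer of the other.
  filter_upwards [hIoo] with α hα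
  obtain ⟨a₁, -, h₁⟩ := Finset.exists_mem_eq_inf' Finset.univ_nonempty fun a => M.cost s a +
      α * M.nextExp s a fun x => M.discValue α x - M.discValue α s₀
  obtain ⟨a₂, -, h₂⟩ := Finset.exists_mem_eq_inf' Finset.univ_nonempty fun a =>
      M.cost s a + α * M.nextExp s a (M.discValue α)
  have h₃ : ∀ a, M.nextExp s a (fun x => M.discValue α x - M.discValue α s₀) =
      M.nextExp s a (M.discValue α) - M.discValue α s₀ := fun a => by
    simp only [sub_eq_add_neg]
    rw [M.nextExp_add, M.nextExp_const]
  have h₄ := Finset.inf'_le (fun a => M.cost s a +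
      α * M.nextExp s a fun x => M.discValue α x - M.discValue α s₀) (Finset.mem_univ a₂)
  have h₅ := Finset.inf'_le (fun a => M.cost s a + α * M.nextExp s a (M.discValue α))
    (Finset.mem_univ a₁)
  rw [← hW.discValue_eq hα.1.le hα.2] at h₂ h₅
  simp only [h₃] at h₁ h₄ ⊢
  refine le_antisymm ?_ ?_ <;> linarith

end IsLyapunov

end NoiseMDP

/-! ### Abelian and Tauberian estimates -/

/-- Summation by parts. -/
theorem sum_pow_mul_eq (α : ℝ) (b : ℕ → ℝ) (T : ℕ) :
    ∑ k ∈ Finset.range T, α ^ k * b k =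
      (1 - α) * ∑ k ∈ Finset.range T, α ^ k * ∑ j ∈ Finset.range (k + 1), b j +
        α ^ T * ∑ j ∈ Finset.range T, b j := by
  induction T with
  | zero => simp
  | succ T ih =>
    rw [Finset.sum_range_succ, ih, Finset.sum_range_succ (fun k => α ^ k * _),
      Finset.sum_range_succ b T]
    ring

theorem one_sub_mul_sum_pow (α : ℝ) (T : ℕ) :
    (1 - α) * ∑ k ∈ Finset.range T, α ^ k = 1 - α ^ T := by
  rw [mul_comm, geom_sum_mul_neg]

/-- The weights `(1 - α) * α ^ k`, for `k < T`, and `α ^ T` add up to one, so the discounted sum is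
a convex combination of partial sums. -/
theorem sum_pow_mul_le {α K : ℝ} (h0 : 0 ≤ α) (h1 : α ≤ 1) {b : ℕ → ℝ}
    (hb : ∀ T, ∑ k ∈ Finset.range T, b k ≤ K) (T : ℕ) :
    ∑ k ∈ Finset.range T, α ^ k * b k ≤ K := by
  rw [sum_pow_mul_eq]
  have h2 : ∑ k ∈ Finset.range T, α ^ k * ∑ j ∈ Finset.range (k + 1), b j ≤
      ∑ k ∈ Finset.range T, α ^ k * K :=
    Finset.sum_le_sum fun k _ => mul_le_mul_of_nonneg_left (hb _) (pow_nonneg h0 k)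
  have h3 := mul_le_mul_of_nonneg_left h2 (sub_nonneg.2 h1)
  rw [← Finset.sum_mul, ← mul_assoc, one_sub_mul_sum_pow] at h3
  have h4 := mul_le_mul_of_nonneg_left (hb T) (pow_nonneg h0 T)
  linarith

/-- A nonnegative sequence with increments bounded above, whose Abel means of second order vanish,
grows more slowly than linearly. -/
theorem tendsto_div_of_abel {E : ℕ → ℝ} (hE : ∀ k, 0 ≤ E k) {J : ℝ} (hJ : 0 ≤ J)
    (hEJ : ∀ k, E (k + 1) ≤ E k + J) {δ : ℝ → ℝ} (hδ : Tendsto δ (𝓝[<] 1) (𝓝 0))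
    (h : ∀ α, 0 < α → α < 1 → ∀ T,
      (1 - α) ^ 2 * ∑ k ∈ Finset.range T, α ^ k * E (k + 1) ≤ δ α) :
    Tendsto (fun T : ℕ => E T / T) atTop (𝓝 0) := by
  have hsq : ∀ T, E T ^ 2 ≤ E 0 ^ 2 + J * E 0 + 2 * J * ∑ k ∈ Finset.range T, E (k + 1) := by
    -- A large value must be preceded by a long stretch of large values. The induction step is `(E
    -- (T + 1) + E T) * (E (T + 1) - E T - J) ≤ 0`.
    suffices hs : ∀ T, E T ^ 2 + J * E T ≤
        E 0 ^ 2 + J * E 0 + 2 * J * ∑ k ∈ Finset.range T, E (k + 1) from fun T => by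
      linarith [hs T, mul_nonneg hJ (hE T)]
    intro T
    induction T with
    | zero => simp
    | succ T ih =>
      rw [Finset.sum_range_succ]
      nlinarith [hEJ T, hE T, hE (T + 1)]
  have hx : Tendsto (fun T : ℕ => 1 / (T : ℝ) / 2) atTop (𝓝 0) := by
    simpa using (tendsto_one_div_atTop_nhds_zero_nat (𝕜 := ℝ)).div_const 2
  -- With `α = 1 - 1 / (2 T)`, Bernoulli's inequality keeps `α ^ k ≥ 1 / 2` for all `k < T`, so the
  -- Abel sum controls half of the plain sum.
  have hα : Tendsto (fun T : ℕ => 1 - 1 / (T : ℝ) / 2) atTop (𝓝[<] 1) := by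
    refine tendsto_nhdsWithin_iff.2 ⟨by simpa using hx.const_sub 1, ?_⟩
    filter_upwards [eventually_gt_atTop 0] with T hT
    have : (0 : ℝ) < 1 / (T : ℝ) / 2 := by positivity
    simp only [Set.mem_Iio]
    linarith
  have hlim : Tendsto (fun T : ℕ => 4 * ((E 0 ^ 2 + J * E 0) * (1 / (T : ℝ) / 2) ^ 2 +
      4 * J * δ (1 - 1 / (T : ℝ) / 2))) atTop (𝓝 0) := by
    simpa using (((hx.pow 2).const_mul
      (E 0 ^ 2 + J * E 0)).add ((hδ.comp hα).const_mul (4 * J))).const_mul 4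
  have hmain : Tendsto (fun T : ℕ => (E T / T) ^ 2) atTop (𝓝 0) := by
    refine squeeze_zero' (Eventually.of_forall fun T => sq_nonneg _) ?_ hlim
    filter_upwards [eventually_ge_atTop 1] with T hT
    have hT' : (1 : ℝ) ≤ T := by exact_mod_cast hT
    have hT0 : (0 : ℝ) < T := by linarith
    set x : ℝ := 1 / (T : ℝ) / 2 with hx
    have hx0 : 0 < x := by positivity
    have hTx : (T : ℝ) * x = 1 / 2 := by rw [hx]; field_simp
    have hx1 : x ≤ 1 / 2 := by nlinarith
    have hpow : ∀ k ∈ Finset.range T, (1 / 2 : ℝ) ≤ (1 - x) ^ k := fun k hk => by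
      have hk' : (k : ℝ) ≤ T := by exact_mod_cast (Finset.mem_range.1 hk).le
      have h1 := one_add_mul_le_pow (a := -x) (by linarith) k
      rw [← sub_eq_add_neg] at h1
      nlinarith
    have h1 := h (1 - x) (by linarith) (by linarith) T
    have h2 : (1 / 2) * ∑ k ∈ Finset.range T, E (k + 1) ≤
        ∑ k ∈ Finset.range T, (1 - x) ^ k * E (k + 1) := by
      rw [Finset.mul_sum]
      exact Finset.sum_le_sum fun k hk => mul_le_mul_of_nonneg_right (hpow k hk) (hE _)
    have h3 : (E T / T) ^ 2 = 4 * (E T ^ 2 * x ^ 2) := by rw [hx]; field_simp; ring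
    rw [h3]
    have h4 := mul_le_mul_of_nonneg_right (hsq T) (sq_nonneg x)
    have h5 := mul_le_mul_of_nonneg_left h2 (sq_nonneg x)
    rw [show (1 : ℝ) - (1 - x) = x by ring] at h1
    have h6 := mul_le_mul_of_nonneg_left (h5.trans h1) hJ
    linarith
  have := hmain.sqrt
  simp only [Real.sqrt_sq_eq_abs, Real.sqrt_zero] at this
  exact (tendsto_zero_iff_abs_tendsto_zero _).2 this

/-! ### The average cost optimality equation of the scheduling problem -/

instance {n m : ℕ} : Nonempty (Action n m) := ⟨⟨fun _ => false, by simp⟩⟩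

/-- A potential that compares the shifted cost `c (k + 1)` with multiples of `c k - B`. -/
theorem exists_potential {c : ℕ → ℝ} (hc : Monotone c) {C : ℝ}
    (hC : ∀ k, c (k + 1) ≤ C * (c k + 1)) (h0 : ∀ k, 0 ≤ c k) (B : ℝ) :
    ∃ D : ℝ, 0 ≤ D ∧ ∃ R : ℕ → ℝ, (∀ k, 0 ≤ R k) ∧
      ∀ k, c (k + 1) - c k + R (k + 1) ≤ D * (c k - B) + R k := by
  -- If `c` is bounded, the increments telescope against `b - c k` and `D = 0` suffices.
  by_cases hb : BddAbove (Set.range c)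
  · obtain ⟨b, hb⟩ := hb
    refine ⟨0, le_rfl, fun k => b - c k, fun k => sub_nonneg.2 (hb ⟨k, rfl⟩), fun k => ?_⟩
    simp only
    linarith
  -- Beyond `k₀`, `c k` is so large that `2 * C' * (c k - B)` exceeds `C' * (c k + 1)` and no
  -- potential is needed. Before `k₀` the potential pays `M` per step; the truncated subtraction
  -- makes it vanish from `k₀` on.
  · have htop := (tendsto_atTop_atTop_of_monotone' hc hb).eventually_ge_atTop (2 * |B| + 1)
    obtain ⟨k₀, hk₀⟩ := eventually_atTop.1 htop
    have hB := le_abs_self B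
    set C' := |C| with hC'
    have hC0 : 0 ≤ C' := abs_nonneg C
    set M := C' * (2 * |B| + 1) with hM
    have hM0 : 0 ≤ M := by positivity
    refine ⟨2 * C', by positivity, fun k => M * ((k₀ - k : ℕ) : ℝ), fun k => by positivity,
      fun k => ?_⟩
    have h1 : c (k + 1) ≤ C' * (c k + 1) :=
      (hC k).trans (mul_le_mul_of_nonneg_right (le_abs_self C) (by linarith [h0 k]))
    simp only
    rcases lt_or_ge k k₀ with hk | hk
    · have h2 : ((k₀ - k : ℕ) : ℝ) = ((k₀ - (k + 1) : ℕ) : ℝ) + 1 := by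
        have : k₀ - k = (k₀ - (k + 1)) + 1 := by omega
        rw [this]; push_cast; ring
      rw [h2]
      nlinarith [mul_nonneg hC0 (h0 k), mul_le_mul_of_nonneg_left hB hC0, h0 k]
    · have h2 : k₀ - k = 0 := by omega
      have h3 : k₀ - (k + 1) = 0 := by omega
      rw [h2, h3]
      nlinarith [hk₀ k hk, mul_le_mul_of_nonneg_left hB hC0, h0 k,
        mul_le_mul_of_nonneg_left (hk₀ k hk) hC0]

namespace Network

variable {n : ℕ} (N : Network n)

/-- A bound of the transmission costs. -/
noncomputable def costShift : ℝ := ∑ i, |N.cc i|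

theorem sum_estCost_le {m : ℕ} (s : State n) (a : Action n m) :
    ∑ i, N.estCost i (s i) ≤ N.cost s a + N.costShift := by
  rw [cost, costShift, ← Finset.sum_add_distrib]
  refine Finset.sum_le_sum fun i _ => ?_
  have : 0 ≤ N.cc i * ((a.1 i).toNat : ℝ) + |N.cc i| := by
    cases a.1 i
    · simp
    · simpa using neg_le_iff_add_nonneg.1 (neg_abs_le (N.cc i))
  linarith

/-- The scheduling problem with costs shifted to be nonnegative. -/
noncomputable def toMDP (m : ℕ) (h0 : ∀ i t, 0 ≤ N.estCost i t) :
    NoiseMDP (State n) (Action n m) (Fin n → Bool) where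
  prob := N.noiseProb
  step := next
  cost s a := N.cost s a + N.costShift
  prob_nonneg := N.noiseProb_nonneg
  sum_prob := N.sum_noiseProb
  cost_nonneg s a := (Finset.sum_nonneg fun i _ => h0 i (s i)).trans (N.sum_estCost_le s a)

variable {N} {m : ℕ}

theorem next_mono {s s' : State n} (a : Action n m) (ω : Fin n → Bool) (h : s ≤ s') :
    next s a ω ≤ next s' a ω := fun i => by
  simp only [next]
  split_ifs
  · exact le_rfl
  · exact Nat.succ_le_succ (h i)

/-- The coupling: a reception of process `i` erases its extra unit of age; otherwise the extra unit
is carried along. -/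
theorem next_update (s : State n) (i : Fin n) (a : Action n m) (ω : Fin n → Bool) :
    next (Function.update s i (s i + 1)) a ω = next s a ω ∨
      (next (Function.update s i (s i + 1)) a ω =
        Function.update (next s a ω) i (next s a ω i + 1) ∧ next s a ω i = s i + 1) := by
  by_cases h : a.1 i = true ∧ ω i = true
  · refine Or.inl (funext fun j => ?_)
    by_cases hj : j = i
    · subst hj
      simp [next, h]
    · simp [next, hj]
  · refine Or.inr ⟨funext fun j => ?_, if_neg h⟩
    by_cases hj : j = i
    · subst hj
      simp [next, h]
    · simp [next, hj]

theorem cost_mono (hmono : ∀ i, Monotone (N.estCost i)) {s s' : State n} (a : Action n m)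
    (h : s ≤ s') : N.cost s a ≤ N.cost s' a :=
  Finset.sum_le_sum fun i _ => by linarith [hmono i (h i)]

theorem cost_update (s : State n) (i : Fin n) (a : Action n m) :
    N.cost (Function.update s i (s i + 1)) a =
      N.cost s a + (N.estCost i (s i + 1) - N.estCost i (s i)) := by
  rw [← sub_eq_iff_eq_add', cost, cost, ← Finset.sum_sub_distrib, Finset.sum_eq_single i]
  · simp
  · intro j _ hj
    simp [hj]
  · simp

/-! ### Relative discounted values -/

section

variable {h0 : ∀ i t, 0 ≤ N.estCost i t} {W : State n → ℝ} {B : ℝ}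

theorem discValue_zero_le (hmono : ∀ i, Monotone (N.estCost i))
    (hW : (N.toMDP m h0).IsLyapunov W B) {α : ℝ} (hα0 : 0 ≤ α) (hα1 : α < 1) (s : State n) :
    (N.toMDP m h0).discValue α 0 ≤ (N.toMDP m h0).discValue α s :=
  hW.discValue_mono (fun _ _ a ω h => next_mono a ω h)
    (fun _ _ a h => add_le_add_left (cost_mono hmono a h) _) hα0 hα1 (fun _ => Nat.zero_le _)

/-- Any state is reached from `0` by raising ages one unit at a time, and each unit is paid for by
`discValue_up_le`. -/
theorem exists_discValue_sub_le (hmono : ∀ i, Monotone (N.estCost i))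
    (hgrow : ∀ i, ∃ C, ∀ k, N.estCost i (k + 1) ≤ C * (N.estCost i k + 1))
    (hW : (N.toMDP m h0).IsLyapunov W B) (s : State n) :
    ∃ K, ∀ α, 0 ≤ α → α < 1 →
      (N.toMDP m h0).discValue α s - (N.toMDP m h0).discValue α 0 ≤ K := by
  induction hT : ∑ i, s i generalizing s with
  | zero =>
    have : s = 0 := funext fun i => by
      simpa using (Finset.sum_eq_zero_iff.1 hT) i (Finset.mem_univ i)
    subst this
    exact ⟨0, fun α _ _ => by simp⟩
  | succ T ih =>
    obtain ⟨i, hi⟩ : ∃ i, 0 < s i := by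
      by_contra! h
      have : ∑ i, s i = 0 := Finset.sum_eq_zero fun i _ => Nat.le_zero.1 (h i)
      omega
    set z := Function.update s i (s i - 1) with hz
    have hzi : z i + 1 = s i := by simp [hz]; omega
    have hsz : s = Function.update z i (z i + 1) := by
      rw [hzi, hz, Function.update_idem, Function.update_eq_self]
    have hzT : ∑ i, z i = T := by
      have h1 := Finset.add_sum_erase Finset.univ s (Finset.mem_univ i)
      have h2 := Finset.add_sum_erase Finset.univ z (Finset.mem_univ i)
      have h3 : ∑ j ∈ Finset.univ.erase i, z j = ∑ j ∈ Finset.univ.erase i, s j :=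
        Finset.sum_congr rfl fun j hj => by simp [hz, Finset.ne_of_mem_erase hj]
      omega
    obtain ⟨K, hK⟩ := ih z hzT
    obtain ⟨C, hC⟩ := hgrow i
    -- `W 0 + B` bounds `(1 - α) V_α(0)` for all `α`, so `D` and `R` do not depend on `α`.
    obtain ⟨D, hD, R, hR, hDR⟩ := exists_potential (hmono i) hC (h0 i) (W 0 + B)
    refine ⟨(1 + D) * K + R (z i), fun α hα0 hα1 => ?_⟩
    have h1 := hW.discValue_up_le hα0 hα1 (discValue_zero_le hmono hW hα0 hα1)
      (hW.one_sub_mul_discValue_mem hα0 hα1 0).2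
      (up := fun s => Function.update s i (s i + 1)) (τ := fun s => s i)
      (fun z a ω => next_update z i a ω) hD hR (fun z a => by
        have h2 := hDR (z i)
        have h3 : N.estCost i (z i) ≤ N.cost z a + N.costShift :=
          (Finset.single_le_sum (fun j _ => h0 j (z j)) (Finset.mem_univ i)).trans
            (N.sum_estCost_le z a)
        have h4 := mul_le_mul_of_nonneg_left h3 hD
        simp only [toMDP, cost_update]
        linarith) z
    rw [hsz]
    refine h1.trans ?_
    have := hK α hα0 hα1
    gcongr

/-! ### Total costs of policies and the optimality theorem -/

/-- The partial sums of the shifted expected costs. -/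
noncomputable def totalCost (N : Network n) (π : Policy n m) (s₀ : State n) (T : ℕ) : ℝ :=
  ∑ k ∈ Finset.range T, (N.expectedCost π s₀ k + N.costShift)

theorem shiftedCost_eq (N : Network n) (π : Policy n m) (s₀ : State n) (k : ℕ) :
    N.expectedCost π s₀ k + N.costShift = pmfExp (N.historyLaw π s₀ k) fun x =>
      pmfExp (π k x.1 x.2) fun a => N.cost x.2 a + N.costShift := by
  simp only [expectedCost_eq, pmfExp_add (Set.toFinite _), pmfExp_const (Set.toFinite _),
    pmfExp_add (N.finite_support_historyLaw π s₀ k),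
    pmfExp_const (N.finite_support_historyLaw π s₀ k)]

theorem shiftedCost_nonneg (h0 : ∀ i t, 0 ≤ N.estCost i t) (π : Policy n m) (s₀ : State n)
    (k : ℕ) : 0 ≤ N.expectedCost π s₀ k + N.costShift := by
  rw [shiftedCost_eq]
  exact pmfExp_nonneg _ fun x => pmfExp_nonneg _ fun a => (N.toMDP m h0).cost_nonneg x.2 a

theorem shiftedCost_add_stateExp (N : Network n) (π : Policy n m) (s₀ : State n) (k : ℕ) (α : ℝ)
    (w : State n → ℝ) :
    N.expectedCost π s₀ k + N.costShift + α * N.stateExp π s₀ (k + 1) w =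
      pmfExp (N.historyLaw π s₀ k) fun x => pmfExp (π k x.1 x.2) fun a =>
        N.cost x.2 a + N.costShift + α * ∑ ω, N.noiseProb ω * w (next x.2 a ω) := by
  rw [shiftedCost_eq, stateExp_succ, ← pmfExp_const_mul,
    ← pmfExp_add (N.finite_support_historyLaw π s₀ k)]
  refine pmfExp_congr fun x _ => ?_
  rw [← pmfExp_const_mul, ← pmfExp_add (Set.toFinite _)]

/-- Whatever the history, a randomized action costs on average at least the minimum in the
recursion, which depends on the current state only. The starting time `k` is general so that the
induction can advance it. -/
theorem stateExp_valueIter_le (h0 : ∀ i t, 0 ≤ N.estCost i t) (π : Policy n m) (s₀ : State n)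
    {α : ℝ} (hα : 0 ≤ α) (T k : ℕ) :
    N.stateExp π s₀ k ((N.toMDP m h0).valueIter α T) ≤
      ∑ j ∈ Finset.range T, α ^ j * (N.expectedCost π s₀ (k + j) + N.costShift) := by
  induction T generalizing k with
  | zero => simp [stateExp, NoiseMDP.valueIter, pmfExp]
  | succ T ih =>
    have h1 : N.stateExp π s₀ k ((N.toMDP m h0).valueIter α (T + 1)) ≤
        N.expectedCost π s₀ k + N.costShift +
          α * N.stateExp π s₀ (k + 1) ((N.toMDP m h0).valueIter α T) := by
      rw [shiftedCost_add_stateExp]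
      refine pmfExp_mono (N.finite_support_historyLaw π s₀ k) fun x => ?_
      rw [← pmfExp_const (p := π k x.1 x.2) (Set.toFinite _)
        ((N.toMDP m h0).valueIter α (T + 1) x.2)]
      exact pmfExp_mono (Set.toFinite _) fun a => (N.toMDP m h0).valueIter_succ_le α T x.2 a
    rw [Finset.sum_range_succ']
    have h2 := mul_le_mul_of_nonneg_left (ih (k + 1)) hα
    rw [Finset.mul_sum] at h2
    have h3 : ∀ j ∈ Finset.range T,
        α * (α ^ j * (N.expectedCost π s₀ (k + 1 + j) + N.costShift)) =
          α ^ (j + 1) * (N.expectedCost π s₀ (k + (j + 1)) + N.costShift) := fun j _ => by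
      rw [show k + 1 + j = k + (j + 1) by ring]; ring
    rw [Finset.sum_congr rfl h3] at h2
    simp only [pow_zero, one_mul, add_zero]
    linarith

theorem valueIter_le_sum (h0 : ∀ i t, 0 ≤ N.estCost i t) (π : Policy n m) (s₀ : State n)
    {α : ℝ} (hα : 0 ≤ α) (T : ℕ) :
    (N.toMDP m h0).valueIter α T s₀ ≤
      ∑ j ∈ Finset.range T, α ^ j * (N.expectedCost π s₀ j + N.costShift) := by
  simpa [stateExp_zero] using stateExp_valueIter_le h0 π s₀ hα T 0

/-- If the time averages are eventually at most `r`, so is the limit of the Abel means of the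
optimal discounted values. -/
theorem le_of_eventually_totalCost_le (hW : (N.toMDP m h0).IsLyapunov W B) {l : Filter ℝ} [l.NeBot]
    (hl : l ≤ 𝓝[<] 1) {s₀ : State n} {J : ℝ}
    (hJ : Tendsto (fun α => (1 - α) * (N.toMDP m h0).discValue α s₀) l (𝓝 J))
    (π : Policy n m) {r : ℝ} (hr : ∀ᶠ T : ℕ in atTop, N.totalCost π s₀ T ≤ r * T) : J ≤ r := by
  obtain ⟨T₀, hT₀⟩ := eventually_atTop.1 hr
  -- `K` absorbs the finitely many horizons before `T₀`; its contribution `(1 - α) * K` vanishes in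
  -- the limit.
  set K := ∑ t ∈ Finset.range T₀, |N.totalCost π s₀ t - r * t| with hK
  have hK0 : 0 ≤ K := Finset.sum_nonneg fun _ _ => abs_nonneg _
  have hb : ∀ T, ∑ k ∈ Finset.range T, (N.expectedCost π s₀ k + N.costShift - r) ≤ K := fun T => by
    rw [Finset.sum_sub_distrib, Finset.sum_const, Finset.card_range, nsmul_eq_mul, mul_comm]
    rcases lt_or_ge T T₀ with h | h
    · refine (le_abs_self _).trans ?_
      exact Finset.single_le_sum (f := fun t : ℕ => |N.totalCost π s₀ t - r * t|)
        (fun _ _ => abs_nonneg _) (Finset.mem_range.2 h)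
    · have := hT₀ T h
      rw [totalCost] at this
      linarith
  have hmain : ∀ α : ℝ, 0 < α → α < 1 →
      (1 - α) * (N.toMDP m h0).discValue α s₀ ≤ (1 - α) * K + r := fun α hα0 hα1 => by
    have h1 : ∀ T, (1 - α) * (N.toMDP m h0).valueIter α T s₀ ≤ (1 - α) * K + r * (1 - α ^ T) :=
      fun T => by
        have h2 := sum_pow_mul_le hα0.le hα1.le hb T
        simp only [mul_sub, Finset.sum_sub_distrib, ← Finset.sum_mul] at h2
        have h3 := (valueIter_le_sum h0 π s₀ hα0.le T).trans (sub_le_iff_le_add.1 h2)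
        have h4 := mul_le_mul_of_nonneg_left h3 (sub_pos.2 hα1).le
        rw [← one_sub_mul_sum_pow]
        linarith
    have h5 : Tendsto (fun T : ℕ => (1 - α) * K + r * (1 - α ^ T)) atTop
        (𝓝 ((1 - α) * K + r * (1 - 0))) :=
      (((tendsto_pow_atTop_nhds_zero_of_lt_one hα0.le hα1).const_sub 1).const_mul r).const_add _
    simpa using le_of_tendsto_of_tendsto'
      ((hW.tendsto_valueIter hα0.le hα1 s₀).const_mul (1 - α)) h5 h1
  have h6 : Tendsto (fun α : ℝ => (1 - α) * K + r) l (𝓝 ((1 - 1) * K + r)) :=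
    (((tendsto_id'.2 (hl.trans nhdsWithin_le_nhds)).const_sub 1).mul_const K).add_const r
  rw [sub_self, zero_mul, zero_add] at h6
  refine le_of_tendsto_of_tendsto hJ h6 ?_
  filter_upwards [hl (Ioo_mem_nhdsLT zero_lt_one)] with α hα
  exact hmain α hα.1 hα.2

/-- The total cost of a stationary rule that satisfies the optimality equation. -/
theorem totalCost_stationary {J : ℝ} {V : State n → ℝ} {f : State n → Action n m}
    (hf : ∀ s, J + V s = N.cost s (f s) + N.costShift +
      ∑ ω, N.noiseProb ω * V (next s (f s) ω)) (s₀ : State n) (T : ℕ) :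
    N.totalCost (stationaryPolicy f) s₀ T + N.stateExp (stationaryPolicy f) s₀ T V =
      T * J + V s₀ := by
  have h : ∀ k, N.expectedCost (stationaryPolicy f) s₀ k + N.costShift +
      N.stateExp (stationaryPolicy f) s₀ (k + 1) V =
        J + N.stateExp (stationaryPolicy f) s₀ k V := fun k => by
    have h1 := shiftedCost_add_stateExp N (stationaryPolicy f) s₀ k 1 V
    rw [one_mul] at h1
    rw [h1, stateExp, ← pmfExp_const (N.finite_support_historyLaw (stationaryPolicy f) s₀ k) J,
      ← pmfExp_add (N.finite_support_historyLaw _ s₀ k)]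
    refine pmfExp_congr fun x _ => ?_
    simp only [stationaryPolicy, pmfExp_pure, one_mul, hf]
  induction T with
  | zero => simp [totalCost, stateExp_zero]
  | succ T ih =>
    rw [totalCost, Finset.sum_range_succ, ← totalCost]
    push_cast
    linarith [h T]

theorem totalCost_stationary_le {J : ℝ} {V : State n → ℝ} (hV : ∀ s, 0 ≤ V s)
    {f : State n → Action n m} (hf : ∀ s, J + V s = N.cost s (f s) + N.costShift +
      ∑ ω, N.noiseProb ω * V (next s (f s) ω)) (s₀ : State n) (T : ℕ) :
    N.totalCost (stationaryPolicy f) s₀ T ≤ T * J + V s₀ := by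
  rw [← totalCost_stationary hf s₀ T]
  exact le_add_of_nonneg_right (pmfExp_nonneg _ fun x => hV x.2)

theorem timeAverage_eq (N : Network n) (π : Policy n m) (s₀ : State n) (T : ℕ) :
    N.timeAverage π s₀ T = N.totalCost π s₀ (T + 1) / ((T + 1 : ℕ) : ℝ) - N.costShift := by
  rw [timeAverage, totalCost, Finset.sum_add_distrib, Finset.sum_const, Finset.card_range,
    nsmul_eq_mul]
  push_cast
  have : (T : ℝ) + 1 ≠ 0 := by positivity
  field_simp
  ring

theorem exists_optimal (hmono : ∀ i, Monotone (N.estCost i))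
    (hgrow : ∀ i, ∃ C, ∀ k, N.estCost i (k + 1) ≤ C * (N.estCost i k + 1))
    (hW : (N.toMDP m h0).IsLyapunov W B) :
    ∃ (J : ℝ) (V : State n → ℝ) (f : State n → Action n m),
      (∀ s, IsLeast (Set.range fun a : Action n m => N.bellmanValue V s a) (J + V s)) ∧
      (∀ s, J + V s = N.bellmanValue V s (f s)) ∧
      (∀ s₀ : State n,
        Tendsto (fun T => N.timeAverage (stationaryPolicy f) s₀ T) atTop (𝓝 J) ∧
        N.averageCost (stationaryPolicy f) s₀ = (J : EReal) ∧
        IsLeast (Set.range fun π : Policy n m => N.averageCost π s₀) (J : EReal)) := by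
  choose K hK using exists_discValue_sub_le hmono hgrow hW
  have hK' : ∀ α, 0 ≤ α → α < 1 → ∀ s, (N.toMDP m h0).discValue α s -
      (N.toMDP m h0).discValue α 0 ∈ Set.Icc 0 (K s) := fun α hα0 hα1 s =>
    ⟨sub_nonneg.2 (discValue_zero_le hmono hW hα0 hα1 s), hK s α hα0 hα1⟩
  have hsol : ∀ U : Ultrafilter ℝ, ↑U ≤ 𝓝[<] (1 : ℝ) → ∃ (J : ℝ) (V : State n → ℝ)
      (f : State n → Action n m),
      Tendsto (fun α => (1 - α) * (N.toMDP m h0).discValue α 0) U (𝓝 J) ∧ (∀ s, 0 ≤ V s) ∧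
      (∀ s a, J + V s ≤ N.cost s a + N.costShift + ∑ ω, N.noiseProb ω * V (next s a ω)) ∧
      (∀ s, J + V s = N.cost s (f s) + N.costShift +
        ∑ ω, N.noiseProb ω * V (next s (f s) ω)) := fun U hU => by
    obtain ⟨J, V, hJ, -, hV, hJV⟩ := hW.exists_tendsto hU hK'
    choose f _ hf using fun s => Finset.exists_mem_eq_inf' Finset.univ_nonempty fun a =>
      (N.toMDP m h0).cost s a + (N.toMDP m h0).nextExp s a V
    exact ⟨J, V, f, hJ, hV, fun s a => (hJV s).trans_le (Finset.inf'_le _ (Finset.mem_univ a)),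
      fun s => (hJV s).trans (hf s)⟩
  -- The rule built from `U'` has averages at most `J' + ε` eventually, and the Abelian bound along
  -- `U` then gives `J ≤ J' + ε`. Hence all ultrafilters yield the same constant and the limit
  -- exists as `α` increases to `1`; the Tauberian step needs this full limit.
  have hle : ∀ (U U' : Ultrafilter ℝ) (J J' : ℝ), ↑U ≤ 𝓝[<] (1 : ℝ) → ↑U' ≤ 𝓝[<] (1 : ℝ) →
      Tendsto (fun α => (1 - α) * (N.toMDP m h0).discValue α 0) U (𝓝 J) →
      Tendsto (fun α => (1 - α) * (N.toMDP m h0).discValue α 0) U' (𝓝 J') → J ≤ J' := by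
    intro U U' J J' hU hU' hJ hJ'
    obtain ⟨J₁, V, f, hJ₁, hV, -, hf⟩ := hsol U' hU'
    obtain rfl := tendsto_nhds_unique hJ' hJ₁
    refine le_of_forall_pos_le_add fun ε hε => ?_
    refine le_of_eventually_totalCost_le hW hU hJ (stationaryPolicy f) ?_
    filter_upwards [(tendsto_natCast_atTop_atTop (R := ℝ)).eventually_ge_atTop (V 0 / ε)]
      with T hT
    have h1 := totalCost_stationary_le hV hf 0 T
    rw [div_le_iff₀ hε] at hT
    linarith
  obtain ⟨J, V, f, hJU, hV, hmin, hf⟩ := hsol (Ultrafilter.of (𝓝[<] 1)) (Ultrafilter.of_le _)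
  have hJ0 : Tendsto (fun α => (1 - α) * (N.toMDP m h0).discValue α 0) (𝓝[<] 1) (𝓝 J) := by
    refine (tendsto_iff_ultrafilter _ _ _).2 fun U hU => ?_
    obtain ⟨J', -, -, hJ', -⟩ := hsol U hU
    have : J' = J := le_antisymm (hle _ _ _ _ hU (Ultrafilter.of_le _) hJ' hJU)
      (hle _ _ _ _ (Ultrafilter.of_le _) hU hJU hJ')
    exact this ▸ hJ'
  have hid : Tendsto (fun α : ℝ => 1 - α) (𝓝[<] 1) (𝓝 0) := by
    simpa using (tendsto_id'.2 (nhdsWithin_le_nhds (a := (1 : ℝ)) (s := Set.Iio 1))).const_sub 1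
  have hJ : ∀ s, Tendsto (fun α => (1 - α) * (N.toMDP m h0).discValue α s) (𝓝[<] 1) (𝓝 J) := by
    intro s
    have h1 : Tendsto (fun α => (1 - α) * ((N.toMDP m h0).discValue α s -
        (N.toMDP m h0).discValue α 0)) (𝓝[<] 1) (𝓝 0) := by
      have h2 : Tendsto (fun α : ℝ => (1 - α) * K s) (𝓝[<] 1) (𝓝 0) := by
        simpa using hid.mul_const (K s)
      refine squeeze_zero' ?_ ?_ h2 <;>
      filter_upwards [Ioo_mem_nhdsLT (zero_lt_one' ℝ)] with α hα
      · exact mul_nonneg (sub_nonneg.2 hα.2.le) (hK' α hα.1.le hα.2 s).1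
      · exact mul_le_mul_of_nonneg_left (hK' α hα.1.le hα.2 s).2 (sub_nonneg.2 hα.2.le)
    have h3 := hJ0.add h1
    rw [add_zero] at h3
    exact h3.congr fun α => by ring
  have hJnonneg : 0 ≤ J := by
    refine ge_of_tendsto hJ0 ?_
    filter_upwards [Ioo_mem_nhdsLT (zero_lt_one' ℝ)] with α hα
    exact (hW.one_sub_mul_discValue_mem hα.1.le hα.2 0).1
  -- The Abel mean of the shifted costs of `f` is `J + (1 - α) * V s₀ - (1 - α) ^ 2 * ∑ α ^ k * E (k
  -- + 1)`, and it is at least `(1 - α) V_α(s₀)`. This bounds the second-order Abel mean of `E` by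
  -- `δ α`. The increments of `E` are at most `J` because the shifted costs are nonnegative.
  have hsmall : ∀ s₀, Tendsto (fun T : ℕ => N.stateExp (stationaryPolicy f) s₀ T V / T) atTop
      (𝓝 0) := fun s₀ => by
    have htot := totalCost_stationary hf s₀
    refine tendsto_div_of_abel (fun k => pmfExp_nonneg _ fun x => hV x.2) hJnonneg (fun k => ?_)
      (δ := fun α => J + (1 - α) * V s₀ - (1 - α) * (N.toMDP m h0).discValue α s₀) ?_ ?_
    · have h1 := htot k
      have h2 := htot (k + 1)
      rw [totalCost, Finset.sum_range_succ, ← totalCost] at h2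
      push_cast at h2
      linarith [shiftedCost_nonneg h0 (stationaryPolicy f) s₀ k]
    · simpa using ((hid.mul_const (V s₀)).const_add J).sub (hJ s₀)
    · intro α hα0 hα1 T
      set E := fun k => N.stateExp (stationaryPolicy f) s₀ k V with hE
      have hE0 : ∀ k, 0 ≤ E k := fun k => pmfExp_nonneg _ fun x => hV x.2
      set b := fun k => N.expectedCost (stationaryPolicy f) s₀ k + N.costShift - J with hb
      have hbE : ∀ k, ∑ j ∈ Finset.range k, b j = V s₀ - E k := fun k => by
        rw [hb, Finset.sum_sub_distrib, ← totalCost, Finset.sum_const, Finset.card_range,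
          nsmul_eq_mul]
        linarith [htot k]
      -- The horizon `T'` will tend to infinity while `T` stays fixed, so that value iteration
      -- becomes the discounted value.
      have h1 : ∀ T', T ≤ T' → (1 - α) * (N.toMDP m h0).valueIter α T' s₀ ≤
          J * (1 - α ^ T') + (1 - α) * V s₀ -
            (1 - α) ^ 2 * ∑ k ∈ Finset.range T, α ^ k * E (k + 1) := fun T' hT' => by
        have h2 := valueIter_le_sum h0 (stationaryPolicy f) s₀ hα0.le T'
        have h3 : ∑ j ∈ Finset.range T', α ^ j *
            (N.expectedCost (stationaryPolicy f) s₀ j + N.costShift) =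
              ∑ j ∈ Finset.range T', α ^ j * b j + J * ∑ j ∈ Finset.range T', α ^ j := by
          rw [Finset.mul_sum, ← Finset.sum_add_distrib]
          exact Finset.sum_congr rfl fun j _ => by simp only [hb]; ring
        have h4 : ∑ k ∈ Finset.range T', α ^ k * ∑ j ∈ Finset.range (k + 1), b j =
            V s₀ * ∑ j ∈ Finset.range T', α ^ j -
              ∑ k ∈ Finset.range T', α ^ k * E (k + 1) := by
          rw [Finset.mul_sum, ← Finset.sum_sub_distrib]
          exact Finset.sum_congr rfl fun j _ => by rw [hbE]; ring
        have h5 : ∑ k ∈ Finset.range T, α ^ k * E (k + 1) ≤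
            ∑ k ∈ Finset.range T', α ^ k * E (k + 1) :=
          Finset.sum_le_sum_of_subset_of_nonneg (Finset.range_mono hT') fun k _ _ =>
            mul_nonneg (pow_nonneg hα0.le k) (hE0 _)
        rw [h3, sum_pow_mul_eq, h4, hbE] at h2
        have h6 := one_sub_mul_sum_pow α T'
        have h7 : 0 < 1 - α := sub_pos.2 hα1
        have h8 := mul_le_mul_of_nonneg_left h2 h7.le
        have h9 := mul_le_mul_of_nonneg_left h5 (sq_nonneg (1 - α))
        have h10 := mul_nonneg h7.le (mul_nonneg (pow_nonneg hα0.le T') (hE0 T'))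
        set G := ∑ j ∈ Finset.range T', α ^ j
        set X := ∑ k ∈ Finset.range T', α ^ k * E (k + 1)
        have h11 : (1 - α) * ((1 - α) * (V s₀ * G - X) + α ^ T' * (V s₀ - E T') + J * G) =
            (1 - α) * V s₀ * ((1 - α) * G) - (1 - α) ^ 2 * X + (1 - α) * α ^ T' * V s₀ -
              (1 - α) * (α ^ T' * E T') + J * ((1 - α) * G) := by ring
        rw [h11, h6] at h8
        linarith
      have h12 : Tendsto (fun T' : ℕ => J * (1 - α ^ T') + (1 - α) * V s₀ -
            (1 - α) ^ 2 * ∑ k ∈ Finset.range T, α ^ k * E (k + 1)) atTop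
          (𝓝 (J * (1 - 0) + (1 - α) * V s₀ -
            (1 - α) ^ 2 * ∑ k ∈ Finset.range T, α ^ k * E (k + 1))) :=
        ((((tendsto_pow_atTop_nhds_zero_of_lt_one hα0.le hα1).const_sub 1).const_mul J).add_const
          _).sub_const _
      have h13 := le_of_tendsto_of_tendsto
        ((hW.tendsto_valueIter hα0.le hα1 s₀).const_mul (1 - α)) h12
        (eventually_atTop.2 ⟨T, h1⟩)
      simp only [hE] at h13
      linarith
  have hlim : ∀ s₀, Tendsto (fun T => N.timeAverage (stationaryPolicy f) s₀ T) atTop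
      (𝓝 (J - N.costShift)) := fun s₀ => by
    have h1 : Tendsto (fun T : ℕ => J + V s₀ / T -
        N.stateExp (stationaryPolicy f) s₀ T V / T) atTop (𝓝 J) := by
      simpa using ((tendsto_const_div_atTop_nhds_zero_nat (V s₀)).const_add J).sub (hsmall s₀)
    have h2 : Tendsto (fun T : ℕ => N.totalCost (stationaryPolicy f) s₀ T / T) atTop (𝓝 J) := by
      refine h1.congr' ?_
      filter_upwards [eventually_gt_atTop 0] with T hT
      have hT' : (T : ℝ) ≠ 0 := by positivity
      have h3 := totalCost_stationary hf s₀ T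
      field_simp
      linarith
    simp only [timeAverage_eq]
    exact (h2.comp (tendsto_add_atTop_nat 1)).sub_const _
  have havg : ∀ s₀, N.averageCost (stationaryPolicy f) s₀ = ((J - N.costShift : ℝ) : EReal) :=
    fun s₀ => ((continuous_coe_real_ereal.tendsto _).comp (hlim s₀)).limsup_eq
  have hbell : ∀ (s : State n) (a : Action n m), N.bellmanValue V s a =
      N.cost s a + ∑ ω, N.noiseProb ω * V (next s a ω) := fun s a => by
    rw [bellmanValue, tsum_transProb]
  have hfB : ∀ s, J - N.costShift + V s = N.bellmanValue V s (f s) := fun s => by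
    rw [hbell]
    linarith [hf s]
  refine ⟨J - N.costShift, V, f, fun s => ⟨⟨f s, (hfB s).symm⟩, ?_⟩, hfB, fun s₀ =>
    ⟨hlim s₀, havg s₀, ⟨stationaryPolicy f, havg s₀⟩, ?_⟩⟩
  · rintro _ ⟨a, rfl⟩
    simp only [hbell]
    linarith [hmin s a]
  · rintro _ ⟨π, rfl⟩
    -- A real `r` strictly between the two averages eventually bounds the time averages, and the
    -- Abelian estimate then contradicts `r < J - N.costShift`.
    by_contra! hlt
    obtain ⟨r, hr1, hr2⟩ := EReal.lt_iff_exists_real_btwn.1 hlt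
    have hr3 : r < J - N.costShift := by exact_mod_cast hr2
    have h1 := eventually_lt_of_limsup_lt hr1
    have h2 : J ≤ r + N.costShift := by
      refine le_of_eventually_totalCost_le hW le_rfl (hJ s₀) π ?_
      refine (eventually_atTop.2 ?_)
      obtain ⟨T₀, hT₀⟩ := eventually_atTop.1 h1
      refine ⟨T₀ + 1, fun T hT => ?_⟩
      obtain ⟨t, rfl⟩ : ∃ t, T = t + 1 := ⟨T - 1, by omega⟩
      have h3 : N.timeAverage π s₀ t < r := by exact_mod_cast hT₀ t (by omega)
      rw [timeAverage_eq, sub_lt_iff_lt_add, div_lt_iff₀ (by positivity)] at h3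
      exact h3.le
    linarith

end

end Network

/-! ### Powers of matrices -/

section GeometricBound

attribute [local instance] Matrix.linftyOpNormedRing Matrix.linftyOpNormedAlgebra

theorem norm_entry_le_linfty {d : ℕ} (M : Matrix (Fin d) (Fin d) ℂ) (i j : Fin d) :
    ‖M i j‖ ≤ ‖M‖ := by
  have h1 : ‖M i j‖₊ ≤ ∑ j, ‖M i j‖₊ :=
    Finset.single_le_sum (f := fun j => ‖M i j‖₊) (fun _ _ => zero_le) (Finset.mem_univ j)
  have h2 : ∑ j, ‖M i j‖₊ ≤ Finset.univ.sup fun i => ∑ j, ‖M i j‖₊ :=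
    Finset.le_sup (f := fun i => ∑ j, ‖M i j‖₊) (Finset.mem_univ i)
  have h3 : ‖M i j‖₊ ≤ ‖M‖₊ := by
    rw [Matrix.linfty_opNNNorm_def]
    exact h1.trans h2
  exact_mod_cast h3

theorem specRad_nonneg {d : ℕ} (A : Matrix (Fin d) (Fin d) ℝ) : 0 ≤ specRad A :=
  ENNReal.toReal_nonneg

/-- Gelfand's formula gives `‖A ^ k‖ ≤ r ^ k` for large `k`; the constant absorbs the remaining
powers. -/
theorem exists_pow_entry_le {d : ℕ} (A : Matrix (Fin d) (Fin d) ℝ) {r : ℝ} (hr : specRad A < r) :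
    ∃ C : ℝ, 0 ≤ C ∧ ∀ k i j, |(A ^ k) i j| ≤ C * r ^ k := by
  rcases Nat.eq_zero_or_pos d with rfl | hd
  · exact ⟨0, le_rfl, fun _ i => i.elim0⟩
  have : Nonempty (Fin d) := ⟨⟨0, hd⟩⟩
  set a : Matrix (Fin d) (Fin d) ℂ := A.map (algebraMap ℝ ℂ) with ha
  have hr0 : 0 < r := (specRad_nonneg A).trans_lt hr
  have hlt : spectralRadius ℂ a < ENNReal.ofReal r := by
    have hfin : spectralRadius ℂ a ≠ ⊤ :=
      ((spectrum.spectralRadius_le_nnnorm a).trans_lt ENNReal.coe_lt_top).ne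
    rw [← ENNReal.ofReal_toReal hfin]
    exact (ENNReal.ofReal_lt_ofReal_iff hr0).2 hr
  have hev := (spectrum.pow_nnnorm_pow_one_div_tendsto_nhds_spectralRadius a).eventually_lt_const hlt
  obtain ⟨k₀, hk₀⟩ := eventually_atTop.1 (hev.and (eventually_gt_atTop 0))
  have hnorm : ∀ k, k₀ ≤ k → ‖a ^ k‖ ≤ r ^ k := fun k hk => by
    obtain ⟨h1, h2⟩ := hk₀ k hk
    have hk0 : (k : ℝ) ≠ 0 := by positivity
    have h3 := ENNReal.rpow_le_rpow h1.le (Nat.cast_nonneg k : (0 : ℝ) ≤ k)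
    rw [← ENNReal.rpow_mul, one_div_mul_cancel hk0, ENNReal.rpow_one, ENNReal.rpow_natCast,
      ← ENNReal.ofReal_pow hr0.le] at h3
    have h4 := ENNReal.toReal_mono ENNReal.ofReal_ne_top h3
    rwa [ENNReal.toReal_ofReal (by positivity), ENNReal.coe_toReal, coe_nnnorm] at h4
  have hsum : 0 ≤ ∑ k ∈ Finset.range k₀, ‖a ^ k‖ / r ^ k :=
    Finset.sum_nonneg fun k _ => by positivity
  refine ⟨1 + ∑ k ∈ Finset.range k₀, ‖a ^ k‖ / r ^ k, by positivity, fun k i j => ?_⟩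
  have h1 : |(A ^ k) i j| ≤ ‖a ^ k‖ := by
    have h2 : (a ^ k) i j = (((A ^ k) i j : ℝ) : ℂ) := by
      rw [ha, ← Matrix.map_pow]
      rfl
    have h3 := norm_entry_le_linfty (a ^ k) i j
    rwa [h2, Complex.norm_real] at h3
  refine h1.trans ?_
  have hrk : 0 < r ^ k := by positivity
  rcases lt_or_ge k k₀ with h | h
  · have h2 : ‖a ^ k‖ / r ^ k ≤ ∑ k ∈ Finset.range k₀, ‖a ^ k‖ / r ^ k :=
      Finset.single_le_sum (f := fun k => ‖a ^ k‖ / r ^ k) (fun k _ => by positivity)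
        (Finset.mem_range.2 h)
    rw [div_le_iff₀ hrk] at h2
    linarith
  · have h2 := hnorm k h
    nlinarith

end GeometricBound

open Matrix

/-- The response of a stable linear recursion to a vanishing input vanishes. -/
theorem tendsto_zero_of_stable_recursion {d e : ℕ} {B : Matrix (Fin d) (Fin d) ℝ}
    (hB : specRad B < 1) {Y U : ℕ → Matrix (Fin e) (Fin d) ℝ}
    (hY : ∀ j, Y (j + 1) = Y j * B + U j) (hU : Tendsto U atTop (𝓝 0)) :
    Tendsto Y atTop (𝓝 0) := by
  obtain ⟨r, hr, hr1⟩ := exists_between hB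
  have hr0 : 0 ≤ r := (specRad_nonneg B).trans hr.le
  obtain ⟨C, hC0, hC⟩ := exists_pow_entry_le B hr
  -- Variation of constants. The sum is then extended by zeros to all `i`, and dominated convergence
  -- applies with a geometric bound.
  have hYj : ∀ j, Y j = Y 0 * B ^ j + ∑ i ∈ Finset.range j, U (j - 1 - i) * B ^ i := fun j => by
    induction j with
    | zero => simp
    | succ j ih =>
      rw [hY, ih, Finset.sum_range_succ', Matrix.add_mul, Matrix.sum_mul, Matrix.mul_assoc, ← pow_succ,
        add_assoc]
      congr 1
      simp only [Nat.add_sub_cancel, Nat.sub_zero, pow_zero, Matrix.mul_one]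
      congr 1
      refine Finset.sum_congr rfl fun i _ => ?_
      rw [Matrix.mul_assoc, ← pow_succ, show j - 1 - i = j - (i + 1) by omega]
  have hUe : ∀ a b, Tendsto (fun j => U j a b) atTop (𝓝 0) := fun a b =>
    tendsto_pi_nhds.1 (tendsto_pi_nhds.1 hU a) b
  have hbd : ∀ a b, ∃ K, ∀ j, |U j a b| ≤ K := fun a b => by
    obtain ⟨K, hK⟩ := (hUe a b).abs.bddAbove_range
    exact ⟨K, fun j => hK ⟨j, rfl⟩⟩
  choose K hK using hbd
  have hBe : ∀ a b, Tendsto (fun j => (B ^ j) a b) atTop (𝓝 0) := fun a b =>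
    squeeze_zero_norm (fun j => hC j a b)
      (by simpa using (tendsto_pow_atTop_nhds_zero_of_lt_one hr0 hr1).const_mul C)
  refine tendsto_pi_nhds.2 fun a => tendsto_pi_nhds.2 fun c => ?_
  have h1 : Tendsto (fun j => (Y 0 * B ^ j : Matrix (Fin e) (Fin d) ℝ) a c) atTop (𝓝 0) := by
    simp only [Matrix.mul_apply]
    simpa using tendsto_finsetSum Finset.univ fun b _ => (hBe b c).const_mul (Y 0 a b)
  have h2 : Tendsto (fun j => ∑' i, if i < j then (U (j - 1 - i) * B ^ i : Matrix (Fin e) (Fin d) ℝ) a c else 0) atTop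
      (𝓝 (∑' _ : ℕ, (0 : ℝ))) := by
    refine tendsto_tsum_of_dominated_convergence
      (bound := fun i => (∑ b, K a b * C) * r ^ i)
      ((summable_geometric_of_lt_one hr0 hr1).mul_left _) (fun i => ?_)
      (Eventually.of_forall fun j i => ?_)
    · have h3 : Tendsto (fun j => (U (j - 1 - i) * B ^ i : Matrix (Fin e) (Fin d) ℝ) a c) atTop (𝓝 0) := by
        simp only [Matrix.mul_apply]
        have h4 : ∀ b, Tendsto (fun j => U (j - 1 - i) a b * (B ^ i) b c) atTop (𝓝 0) := fun b => by
          have h5 : Tendsto (fun j : ℕ => j - 1 - i) atTop atTop :=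
            (tendsto_sub_atTop_nat i).comp (tendsto_sub_atTop_nat 1)
          simpa using ((hUe a b).comp h5).mul_const ((B ^ i) b c)
        simpa using tendsto_finsetSum Finset.univ fun b _ => h4 b
      refine h3.congr' ?_
      filter_upwards [eventually_gt_atTop i] with j hj
      rw [if_pos hj]
    · have h3 : ‖(U (j - 1 - i) * B ^ i : Matrix (Fin e) (Fin d) ℝ) a c‖ ≤ (∑ b, K a b * C) * r ^ i := by
        rw [Matrix.mul_apply, Finset.sum_mul]
        refine (norm_sum_le _ _).trans (Finset.sum_le_sum fun b _ => ?_)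
        rw [norm_mul, mul_assoc]
        exact mul_le_mul (hK a b _) (hC i b c) (norm_nonneg _)
          ((abs_nonneg _).trans (hK a b 0))
      split_ifs
      · exact h3
      · rw [norm_zero]
        exact (norm_nonneg _).trans h3
  rw [tsum_zero] at h2
  have h3 := h1.add h2
  rw [add_zero] at h3
  refine h3.congr fun j => ?_
  rw [hYj j, Matrix.add_apply, Matrix.sum_apply, tsum_eq_sum (s := Finset.range j)]
  · congr 1
    exact Finset.sum_congr rfl fun i hi => if_pos (Finset.mem_range.1 hi)
  · intro i hi
    exact if_neg (by simpa using hi)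

/-! ### Positive semidefinite matrices -/

section PosSemidef

variable {d e : ℕ}

theorem PosSemidef.isSymm' {X : Matrix (Fin d) (Fin d) ℝ} (h : X.PosSemidef) : Xᵀ = X := by
  have := h.1
  rwa [Matrix.IsHermitian, conjTranspose_eq_transpose_of_trivial] at this

theorem posSemidef_of_quadForm {X : Matrix (Fin d) (Fin d) ℝ} (h : Xᵀ = X)
    (hx : ∀ x : Fin d → ℝ, 0 ≤ x ⬝ᵥ X *ᵥ x) : X.PosSemidef := by
  refine Matrix.PosSemidef.of_dotProduct_mulVec_nonneg ?_ fun x => by simpa using hx x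
  rwa [Matrix.IsHermitian, conjTranspose_eq_transpose_of_trivial]

theorem PosSemidef.quadForm_nonneg {X : Matrix (Fin d) (Fin d) ℝ} (h : X.PosSemidef)
    (x : Fin d → ℝ) : 0 ≤ x ⬝ᵥ X *ᵥ x := by
  simpa using h.dotProduct_mulVec_nonneg x

theorem PosSemidef.conj {X : Matrix (Fin d) (Fin d) ℝ} (h : X.PosSemidef)
    (B : Matrix (Fin e) (Fin d) ℝ) : (B * X * Bᵀ).PosSemidef := by
  simpa [conjTranspose_eq_transpose_of_trivial] using h.mul_mul_conjTranspose_same B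

/-- Polarization. It reduces convergence of symmetric matrices to convergence of real sequences,
where order arguments apply. -/
theorem entry_eq_quadForm {X : Matrix (Fin d) (Fin d) ℝ} (h : Xᵀ = X) (i j : Fin d) :
    X i j = ((Pi.single i 1 + Pi.single j 1 : Fin d → ℝ) ⬝ᵥ
        X *ᵥ (Pi.single i 1 + Pi.single j 1) -
      (Pi.single i 1 : Fin d → ℝ) ⬝ᵥ X *ᵥ (Pi.single i 1) -
      (Pi.single j 1 : Fin d → ℝ) ⬝ᵥ X *ᵥ (Pi.single j 1)) / 2 := by
  have h1 : X j i = X i j := congrFun (congrFun h i) j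
  simp only [mulVec_add, add_dotProduct, dotProduct_add, single_dotProduct, mulVec_single_one,
    Matrix.col_apply, one_mul]
  rw [h1]
  ring

/-- The quadratic form at `e_i ± e_j` is nonnegative, and the diagonal entries are at most the
trace. -/
theorem PosSemidef.abs_entry_le {X : Matrix (Fin d) (Fin d) ℝ} (h : X.PosSemidef)
    (i j : Fin d) : |X i j| ≤ X.trace := by
  have hs : X j i = X i j := congrFun (congrFun (PosSemidef.isSymm' h) i) j
  have hd : ∀ i, 0 ≤ X i i := fun i => by
    have := PosSemidef.quadForm_nonneg h (Pi.single i 1)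
    simpa [mulVec_single_one] using this
  have ht : ∀ i, X i i ≤ X.trace := fun i =>
    Finset.single_le_sum (f := fun i => X i i) (fun i _ => hd i) (Finset.mem_univ i)
  have h1 := PosSemidef.quadForm_nonneg h (Pi.single i 1 + Pi.single j 1)
  have h2 := PosSemidef.quadForm_nonneg h (Pi.single i 1 - Pi.single j 1)
  simp only [mulVec_add, add_dotProduct, dotProduct_add, single_dotProduct, mulVec_single_one,
    Matrix.col_apply, one_mul, mulVec_sub, sub_dotProduct, dotProduct_sub] at h1 h2
  rw [hs] at h1 h2
  rw [abs_le]
  constructor <;> linarith [ht i, ht j]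

theorem PosSemidef.trace_conj_le {X : Matrix (Fin d) (Fin d) ℝ} (h : X.PosSemidef)
    {B : Matrix (Fin e) (Fin d) ℝ} {b : ℝ} (hb : ∀ i j, |B i j| ≤ b) :
    (B * X * Bᵀ).trace ≤ (e * d * d) * b ^ 2 * X.trace := by
  have h1 : ∀ i j k, B i k * X k j * B i j ≤ b ^ 2 * X.trace := fun i j k => by
    refine (le_abs_self _).trans ?_
    rw [abs_mul, abs_mul]
    have hb0 : 0 ≤ b := (abs_nonneg _).trans (hb i k)
    have h2 := PosSemidef.abs_entry_le h k j
    calc |B i k| * |X k j| * |B i j| ≤ b * X.trace * b := by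
          gcongr
          · exact mul_nonneg hb0 ((abs_nonneg _).trans h2)
          · exact hb i k
          · exact hb i j
      _ = b ^ 2 * X.trace := by ring
  simp only [Matrix.trace, Matrix.diag_apply, Matrix.mul_apply, Matrix.transpose_apply,
    Finset.sum_mul]
  calc ∑ i, ∑ j, ∑ k, B i k * X k j * B i j
      ≤ ∑ _i : Fin e, ∑ _j : Fin d, ∑ _k : Fin d, b ^ 2 * X.trace :=
        Finset.sum_le_sum fun i _ => Finset.sum_le_sum fun j _ => Finset.sum_le_sum fun k _ =>
          h1 i j k
    _ = _ := by
      simp [Matrix.trace]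
      ring

theorem PosSemidef.quadForm_le {X : Matrix (Fin d) (Fin d) ℝ} (h : X.PosSemidef)
    (x : Fin d → ℝ) : x ⬝ᵥ X *ᵥ x ≤ (∑ i, ∑ j, |x i| * |x j|) * X.trace := by
  simp only [dotProduct, mulVec, Finset.mul_sum, Finset.sum_mul]
  refine Finset.sum_le_sum fun i _ => Finset.sum_le_sum fun j _ => ?_
  refine (le_abs_self _).trans ?_
  rw [abs_mul, abs_mul]
  calc |x i| * (|X i j| * |x j|) = |x i| * |x j| * |X i j| := by ring
    _ ≤ _ := mul_le_mul_of_nonneg_left (PosSemidef.abs_entry_le h i j) (by positivity)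

theorem continuous_quadForm (x : Fin d → ℝ) :
    Continuous fun X : Matrix (Fin d) (Fin d) ℝ => x ⬝ᵥ X *ᵥ x :=
  continuous_const.dotProduct (continuous_id.matrix_mulVec continuous_const)

theorem transpose_eq_of_tendsto {X : ℕ → Matrix (Fin d) (Fin d) ℝ} {P : Matrix (Fin d) (Fin d) ℝ}
    (hX : ∀ k, (X k)ᵀ = X k) (h : Tendsto X atTop (𝓝 P)) : Pᵀ = P := by
  refine tendsto_nhds_unique ((continuous_id.matrix_transpose.tendsto P).comp h) ?_
  exact h.congr fun k => (hX k).symm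

theorem posSemidef_of_tendsto {X : ℕ → Matrix (Fin d) (Fin d) ℝ} {P : Matrix (Fin d) (Fin d) ℝ}
    (hX : ∀ k, (X k).PosSemidef) (h : Tendsto X atTop (𝓝 P)) : P.PosSemidef :=
  posSemidef_of_quadForm (transpose_eq_of_tendsto (fun k => PosSemidef.isSymm' (hX k)) h) fun x =>
    ge_of_tendsto' (((continuous_quadForm x).tendsto P).comp h) fun k =>
      PosSemidef.quadForm_nonneg (hX k) x

theorem tendsto_of_tendsto_quadForm {X : ℕ → Matrix (Fin d) (Fin d) ℝ} (hX : ∀ k, (X k)ᵀ = X k)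
    {l : (Fin d → ℝ) → ℝ} (h : ∀ x, Tendsto (fun k => x ⬝ᵥ X k *ᵥ x) atTop (𝓝 (l x))) :
    Tendsto X atTop (𝓝 (Matrix.of fun i j => (l (Pi.single i 1 + Pi.single j 1) -
      l (Pi.single i 1) - l (Pi.single j 1)) / 2)) := by
  refine tendsto_pi_nhds.2 fun i => tendsto_pi_nhds.2 fun j => ?_
  refine ((((h _).sub (h _)).sub (h _)).div_const 2).congr fun k => ?_
  exact (entry_eq_quadForm (hX k) i j).symm

theorem tendsto_of_squeeze {X Y Z : ℕ → Matrix (Fin d) (Fin d) ℝ} {P : Matrix (Fin d) (Fin d) ℝ}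
    (hXs : ∀ k, (X k)ᵀ = X k) (hZX : ∀ k, (X k - Z k).PosSemidef)
    (hXY : ∀ k, (Y k - X k).PosSemidef) (hPs : Pᵀ = P)
    (hZ : Tendsto Z atTop (𝓝 P)) (hY : Tendsto Y atTop (𝓝 P)) : Tendsto X atTop (𝓝 P) := by
  have h1 : ∀ x, Tendsto (fun k => x ⬝ᵥ X k *ᵥ x) atTop (𝓝 (x ⬝ᵥ P *ᵥ x)) := fun x => by
    refine tendsto_of_tendsto_of_tendsto_of_le_of_le
      (((continuous_quadForm x).tendsto P).comp hZ) (((continuous_quadForm x).tendsto P).comp hY)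
      (fun k => ?_) fun k => ?_
    · have := PosSemidef.quadForm_nonneg (hZX k) x
      rw [sub_mulVec, dotProduct_sub] at this
      exact sub_nonneg.1 this
    · have := PosSemidef.quadForm_nonneg (hXY k) x
      rw [sub_mulVec, dotProduct_sub] at this
      exact sub_nonneg.1 this
  convert! tendsto_of_tendsto_quadForm hXs h1 using 2
  ext i j
  exact entry_eq_quadForm hPs i j

theorem exists_tendsto_of_monotone {X : ℕ → Matrix (Fin d) (Fin d) ℝ}
    (hX : ∀ k, (X k).PosSemidef) (hmono : ∀ k, (X (k + 1) - X k).PosSemidef) {K : ℝ}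
    (hK : ∀ k, (X k).trace ≤ K) : ∃ P, Tendsto X atTop (𝓝 P) := by
  have h1 : ∀ x : Fin d → ℝ, ∃ l, Tendsto (fun k => x ⬝ᵥ X k *ᵥ x) atTop (𝓝 l) := fun x => by
    refine ⟨_, tendsto_atTop_ciSup (monotone_nat_of_le_succ fun k => ?_)
      ⟨(∑ i, ∑ j, |x i| * |x j|) * K, Set.forall_mem_range.2 fun k => ?_⟩⟩
    · have := PosSemidef.quadForm_nonneg (hmono k) x
      rw [sub_mulVec, dotProduct_sub] at this
      exact sub_nonneg.1 this
    · exact (PosSemidef.quadForm_le (hX k) x).trans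
        (mul_le_mul_of_nonneg_left (hK k) (by positivity))
  choose l hl using h1
  exact ⟨_, tendsto_of_tendsto_quadForm (fun k => PosSemidef.isSymm' (hX k)) hl⟩

theorem sqrt_mul_sqrt {Q : Matrix (Fin d) (Fin d) ℝ} (h : Q.PosSemidef) :
    CFC.sqrt Q * (CFC.sqrt Q)ᵀ = Q := by
  have h1 : (CFC.sqrt Q)ᵀ = CFC.sqrt Q :=
    PosSemidef.isSymm' (Matrix.nonneg_iff_posSemidef.1 (CFC.sqrt_nonneg Q))
  rw [h1]
  exact CFC.sqrt_mul_sqrt_self Q h.nonneg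

theorem tendsto_zero_of_trace_mul_transpose {G : ℕ → Matrix (Fin d) (Fin e) ℝ}
    (h : Tendsto (fun k => (G k * (G k)ᵀ).trace) atTop (𝓝 0)) : Tendsto G atTop (𝓝 0) := by
  refine tendsto_pi_nhds.2 fun i => tendsto_pi_nhds.2 fun j => ?_
  have h1 : Tendsto (fun k => (G k i j) ^ 2) atTop (𝓝 0) := by
    refine squeeze_zero (fun k => sq_nonneg _) (fun k => ?_) h
    simp only [Matrix.trace, Matrix.diag_apply, Matrix.mul_apply, Matrix.transpose_apply]
    have h2 : ∀ i, 0 ≤ ∑ j, G k i j * G k i j := fun i =>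
      Finset.sum_nonneg fun j _ => mul_self_nonneg _
    have h3 := Finset.single_le_sum (f := fun j => G k i j * G k i j)
      (fun j _ => mul_self_nonneg _) (Finset.mem_univ j)
    have h4 := Finset.single_le_sum (f := fun i => ∑ j, G k i j * G k i j)
      (fun i _ => h2 i) (Finset.mem_univ i)
    rw [sq]
    exact h3.trans h4
  have h2 := h1.sqrt
  simp only [Real.sqrt_sq_eq_abs, Real.sqrt_zero] at h2
  exact (tendsto_zero_iff_abs_tendsto_zero _).2 h2

end PosSemidef

/-! ### Lyapunov and Riccati recursions -/

section Riccati

variable {d p : ℕ}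

theorem lyap_iterate (A Q X : Matrix (Fin d) (Fin d) ℝ) (k : ℕ) :
    (lyap A Q)^[k] X = A ^ k * X * (A ^ k)ᵀ + ∑ j ∈ Finset.range k, A ^ j * Q * (A ^ j)ᵀ := by
  induction k with
  | zero => simp
  | succ k ih =>
    rw [Function.iterate_succ_apply', ih, lyap, Finset.sum_range_succ', mul_add, add_mul,
      Finset.mul_sum, Finset.sum_mul]
    simp only [pow_succ', transpose_mul, pow_zero, transpose_one, mul_one, one_mul, mul_assoc,
      add_assoc]

theorem lyap_sub (A Q X Y : Matrix (Fin d) (Fin d) ℝ) :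
    lyap A Q Y - lyap A Q X = A * (Y - X) * Aᵀ := by
  simp only [lyap, mul_sub, sub_mul]
  abel

theorem lyap_posSemidef {A Q X : Matrix (Fin d) (Fin d) ℝ} (hQ : Q.PosSemidef)
    (hX : X.PosSemidef) : (lyap A Q X).PosSemidef :=
  (PosSemidef.conj hX A).add hQ

theorem lyap_iterate_posSemidef {A Q X : Matrix (Fin d) (Fin d) ℝ} (hQ : Q.PosSemidef)
    (hX : X.PosSemidef) (k : ℕ) : ((lyap A Q)^[k] X).PosSemidef := by
  induction k with
  | zero => exact hX
  | succ k ih =>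
    rw [Function.iterate_succ_apply']
    exact lyap_posSemidef hQ ih

/-- The traces of the summands of the Lyapunov iteration grow at most geometrically. -/
theorem exists_trace_pow_conj_le {A : Matrix (Fin d) (Fin d) ℝ} {r : ℝ} (hr : specRad A < r) :
    ∃ C : ℝ, 0 ≤ C ∧ ∀ X : Matrix (Fin d) (Fin d) ℝ, X.PosSemidef → ∀ k,
      (A ^ k * X * (A ^ k)ᵀ).trace ≤ C * X.trace * (r ^ 2) ^ k := by
  obtain ⟨C, hC0, hC⟩ := exists_pow_entry_le A hr
  refine ⟨d * d * d * C ^ 2, by positivity, fun X hX k => ?_⟩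
  refine (PosSemidef.trace_conj_le hX (hC k)).trans_eq ?_
  ring

theorem exists_trace_lyap_iterate_le {A Q X : Matrix (Fin d) (Fin d) ℝ} (hA : specRad A < 1)
    (hQ : Q.PosSemidef) (hX : X.PosSemidef) : ∃ K, ∀ k, ((lyap A Q)^[k] X).trace ≤ K := by
  obtain ⟨r, hr, hr1⟩ := exists_between hA
  have hr0 : 0 ≤ r := (specRad_nonneg A).trans hr.le
  obtain ⟨C, hC0, hC⟩ := exists_trace_pow_conj_le hr
  have hr2 : r ^ 2 < 1 := by nlinarith
  refine ⟨C * X.trace + C * Q.trace * (1 - r ^ 2)⁻¹, fun k => ?_⟩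
  rw [lyap_iterate, trace_add, trace_sum]
  have hXt := hX.trace_nonneg
  have hQt := hQ.trace_nonneg
  refine add_le_add ((hC X hX k).trans (mul_le_of_le_one_right (by positivity)
    (pow_le_one₀ (sq_nonneg r) hr2.le))) ?_
  refine (Finset.sum_le_sum fun j _ => hC Q hQ j).trans ?_
  rw [← Finset.mul_sum]
  gcongr
  rw [← tsum_geometric_of_lt_one (sq_nonneg r) hr2]
  exact (summable_geometric_of_lt_one (sq_nonneg r) hr2).sum_le_tsum _ fun _ _ => by positivity

/-- The Riccati operator: a time update after a measurement update. -/
noncomputable def riccati (A : Matrix (Fin d) (Fin d) ℝ) (C : Matrix (Fin p) (Fin d) ℝ)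
    (Q : Matrix (Fin d) (Fin d) ℝ) (R : Matrix (Fin p) (Fin p) ℝ) (X : Matrix (Fin d) (Fin d) ℝ) :
    Matrix (Fin d) (Fin d) ℝ :=
  lyap A Q (measUpdate C R X)

theorem riccati_one (C : Matrix (Fin p) (Fin d) ℝ) (R : Matrix (Fin p) (Fin p) ℝ)
    (X : Matrix (Fin d) (Fin d) ℝ) : riccati 1 C 0 R X = measUpdate C R X := by
  simp [riccati, lyap]

variable {A : Matrix (Fin d) (Fin d) ℝ} {C : Matrix (Fin p) (Fin d) ℝ}
  {Q X Y : Matrix (Fin d) (Fin d) ℝ} {R : Matrix (Fin p) (Fin p) ℝ}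

theorem innovation_posDef (hR : R.PosDef) (hX : X.PosSemidef) : (C * X * Cᵀ + R).PosDef :=
  PosDef.posSemidef_add (PosSemidef.conj hX C) hR

/-- Completion of the square in the gain. -/
theorem joseph_eq (hR : R.PosDef) (hX : X.PosSemidef) (L : Matrix (Fin d) (Fin p) ℝ) :
    lyap (A + L * C) (L * R * Lᵀ + Q) X = riccati A C Q R X +
      (L + A * X * Cᵀ * (C * X * Cᵀ + R)⁻¹) * (C * X * Cᵀ + R) *
        (L + A * X * Cᵀ * (C * X * Cᵀ + R)⁻¹)ᵀ := by
  have hM := innovation_posDef (C := C) hR hX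
  have hXs := PosSemidef.isSymm' hX
  have hMs := PosSemidef.isSymm' hM.posSemidef
  have hdet : IsUnit (C * X * Cᵀ + R).det := (isUnit_iff_isUnit_det _).1 hM.isUnit
  have hR' : R = (C * X * Cᵀ + R) - C * X * Cᵀ := by abel
  generalize hMd : C * X * Cᵀ + R = M at *
  have h1 : M * M⁻¹ = 1 := mul_nonsing_inv M hdet
  have h2 : M⁻¹ * M = 1 := nonsing_inv_mul M hdet
  have h3 : (M⁻¹)ᵀ = M⁻¹ := by rw [transpose_nonsing_inv, hMs]
  have h4 : (L + A * X * Cᵀ * M⁻¹) * M = L * M + A * X * Cᵀ := by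
    rw [Matrix.add_mul, Matrix.mul_assoc _ M⁻¹ M, h2, Matrix.mul_one]
  have h5 : (L + A * X * Cᵀ * M⁻¹)ᵀ = Lᵀ + M⁻¹ * (C * X * Aᵀ) := by
    simp only [transpose_add, transpose_mul, transpose_transpose, h3, hXs, Matrix.mul_assoc]
  have h6 : L * M * (M⁻¹ * (C * X * Aᵀ)) = L * (C * X * Aᵀ) := by
    rw [Matrix.mul_assoc, ← Matrix.mul_assoc M, h1, Matrix.one_mul]
  rw [h4, h5, Matrix.mul_add, Matrix.add_mul, Matrix.add_mul, h6, riccati, lyap, lyap, measUpdate,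
    hMd, hR']
  simp only [transpose_add, transpose_mul, Matrix.mul_add, Matrix.add_mul, Matrix.mul_sub,
    Matrix.sub_mul, Matrix.mul_assoc]
  abel

/-- With `exists_gain`, this makes the Riccati operator the pointwise least of the Lyapunov
operators over all gains `L`. -/
theorem riccati_le_joseph (hR : R.PosDef) (hX : X.PosSemidef) (L : Matrix (Fin d) (Fin p) ℝ) :
    (lyap (A + L * C) (L * R * Lᵀ + Q) X - riccati A C Q R X).PosSemidef := by
  rw [joseph_eq hR hX, add_sub_cancel_left]
  exact PosSemidef.conj (innovation_posDef hR hX).posSemidef _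

theorem exists_gain (A : Matrix (Fin d) (Fin d) ℝ) (C : Matrix (Fin p) (Fin d) ℝ)
    (Q : Matrix (Fin d) (Fin d) ℝ) (hR : R.PosDef) (hX : X.PosSemidef) :
    ∃ L : Matrix (Fin d) (Fin p) ℝ,
      riccati A C Q R X = lyap (A + L * C) (L * R * Lᵀ + Q) X := by
  refine ⟨-(A * X * Cᵀ * (C * X * Cᵀ + R)⁻¹), ?_⟩
  rw [joseph_eq hR hX, neg_add_cancel, Matrix.zero_mul, Matrix.zero_mul, add_zero]

theorem josephNoise_posSemidef (hR : R.PosDef) (hQ : Q.PosSemidef) (L : Matrix (Fin d) (Fin p) ℝ) :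
    (L * R * Lᵀ + Q).PosSemidef :=
  (PosSemidef.conj hR.posSemidef L).add hQ

theorem riccati_posSemidef (hR : R.PosDef) (hQ : Q.PosSemidef) (hX : X.PosSemidef) :
    (riccati A C Q R X).PosSemidef := by
  obtain ⟨L, hL⟩ := exists_gain A C Q hR hX
  rw [hL]
  exact lyap_posSemidef (josephNoise_posSemidef hR hQ L) hX

theorem riccati_iterate_posSemidef (hR : R.PosDef) (hQ : Q.PosSemidef) (hX : X.PosSemidef) (k : ℕ) :
    ((riccati A C Q R)^[k] X).PosSemidef := by
  induction k with
  | zero => exact hX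
  | succ k ih =>
    rw [Function.iterate_succ_apply']
    exact riccati_posSemidef hR hQ ih

/-- A minimum of monotone operators is monotone: the gain optimal for `Y` is merely admissible for
`X`. -/
theorem riccati_mono (hR : R.PosDef) (hX : X.PosSemidef) (hY : Y.PosSemidef)
    (h : (Y - X).PosSemidef) : (riccati A C Q R Y - riccati A C Q R X).PosSemidef := by
  obtain ⟨L, hL⟩ := exists_gain A C Q hR hY
  have h1 := riccati_le_joseph (A := A) (C := C) (Q := Q) hR hX L
  have h2 : (lyap (A + L * C) (L * R * Lᵀ + Q) Y - lyap (A + L * C) (L * R * Lᵀ + Q) X).PosSemidef := by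
    rw [lyap_sub]
    exact PosSemidef.conj h _
  rw [hL]
  simpa using h2.add h1

theorem riccati_iterate_mono (hR : R.PosDef) (hQ : Q.PosSemidef) (hX : X.PosSemidef)
    (hY : Y.PosSemidef) (h : (Y - X).PosSemidef) (k : ℕ) :
    ((riccati A C Q R)^[k] Y - (riccati A C Q R)^[k] X).PosSemidef := by
  induction k with
  | zero => exact h
  | succ k ih =>
    rw [Function.iterate_succ_apply', Function.iterate_succ_apply']
    exact riccati_mono hR (riccati_iterate_posSemidef hR hQ hX k)
      (riccati_iterate_posSemidef hR hQ hY k) ih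

theorem riccati_iterate_le_lyap (hR : R.PosDef) (hQ : Q.PosSemidef) (hX : X.PosSemidef)
    (L : Matrix (Fin d) (Fin p) ℝ) (k : ℕ) :
    ((lyap (A + L * C) (L * R * Lᵀ + Q))^[k] X - (riccati A C Q R)^[k] X).PosSemidef := by
  induction k with
  | zero => simpa using PosSemidef.zero
  | succ k ih =>
    rw [Function.iterate_succ_apply', Function.iterate_succ_apply']
    have h1 := riccati_le_joseph (A := A) (C := C) (Q := Q) hR
      (riccati_iterate_posSemidef (A := A) (C := C) hR hQ hX k) L
    have h2 : (lyap (A + L * C) (L * R * Lᵀ + Q) ((lyap (A + L * C) (L * R * Lᵀ + Q))^[k] X) -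
        lyap (A + L * C) (L * R * Lᵀ + Q) ((riccati A C Q R)^[k] X)).PosSemidef := by
      rw [lyap_sub]
      exact PosSemidef.conj ih _
    simpa using h2.add h1

theorem continuousAt_measUpdate (hR : R.PosDef) (hX : X.PosSemidef) :
    ContinuousAt (measUpdate C R) X := by
  have hM := innovation_posDef (C := C) hR hX
  have h1 : ContinuousAt (fun Y : Matrix (Fin d) (Fin d) ℝ => (C * Y * Cᵀ + R)⁻¹) X := by
    refine ContinuousAt.comp (g := Inv.inv) (f := fun Y => C * Y * Cᵀ + R) ?_ ?_
    · refine continuousAt_matrix_inv _ ?_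
      have h2 := NormedRing.inverse_continuousAt (Units.mk0 _ hM.det_pos.ne')
      rwa [Units.val_mk0] at h2
    · exact (((continuous_const.matrix_mul continuous_id).matrix_mul continuous_const).add
        continuous_const).continuousAt
  have h2 : Continuous fun z : Matrix (Fin d) (Fin d) ℝ × Matrix (Fin p) (Fin p) ℝ =>
      z.1 - z.1 * Cᵀ * z.2 * (C * z.1) :=
    continuous_fst.sub (((continuous_fst.matrix_mul continuous_const).matrix_mul
      continuous_snd).matrix_mul (continuous_const.matrix_mul continuous_fst))
  exact h2.continuousAt.comp (continuousAt_id.prodMk h1)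

theorem continuousAt_riccati (hR : R.PosDef) (hX : X.PosSemidef) :
    ContinuousAt (riccati A C Q R) X := by
  have h1 : Continuous (lyap A Q) :=
    ((continuous_const.matrix_mul continuous_id).matrix_mul continuous_const).add continuous_const
  exact h1.continuousAt.comp (continuousAt_measUpdate hR hX)

/-- Stability of the closed-loop matrix of a solution of the Riccati equation. -/
theorem tendsto_closedLoop_pow (hR : R.PosDef) (hQ : Q.PosSemidef) (hX : X.PosSemidef)
    (hst : Stabilizable A (CFC.sqrt Q)) {L : Matrix (Fin d) (Fin p) ℝ}
    (hL : X = lyap (A + L * C) (L * R * Lᵀ + Q) X) :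
    Tendsto (fun k => (A + L * C) ^ k) atTop (𝓝 0) := by
  set F := A + L * C with hF
  set W := L * R * Lᵀ + Q with hW
  have hWp : W.PosSemidef := josephNoise_posSemidef hR hQ L
  have hfix : ∀ k, (lyap F W)^[k] X = X := fun k => Function.iterate_fixed hL.symm k
  -- Unfolding the fixed point `k` times bounds the partial sums of these nonnegative traces by the
  -- trace of `X`.
  have htr : Tendsto (fun j => (F ^ j * W * (F ^ j)ᵀ).trace) atTop (𝓝 0) := by
    refine Summable.tendsto_atTop_zero (summable_of_sum_range_le (c := X.trace)
      (fun j => (PosSemidef.conj hWp _).trace_nonneg) fun k => ?_)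
    have h1 := congrArg Matrix.trace (hfix k)
    rw [lyap_iterate, trace_add, trace_sum] at h1
    linarith [(PosSemidef.conj hX (F ^ k)).trace_nonneg]
  have hsplit : ∀ j, (F ^ j * W * (F ^ j)ᵀ).trace =
      (F ^ j * L * R * (F ^ j * L)ᵀ).trace + (F ^ j * Q * (F ^ j)ᵀ).trace := fun j => by
    rw [← trace_add, hW, Matrix.mul_add, Matrix.add_mul, transpose_mul]
    simp only [Matrix.mul_assoc]
  have hLR : Tendsto (fun j => F ^ j * L * CFC.sqrt R) atTop (𝓝 0) := by
    refine tendsto_zero_of_trace_mul_transpose (squeeze_zero (fun j => ?_) (fun j => ?_) htr)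
    · simpa [conjTranspose_eq_transpose_of_trivial] using
        (posSemidef_self_mul_conjTranspose (F ^ j * L * CFC.sqrt R)).trace_nonneg
    · rw [hsplit, transpose_mul (F ^ j * L), Matrix.mul_assoc, ← Matrix.mul_assoc (CFC.sqrt R),
        sqrt_mul_sqrt hR.posSemidef, ← Matrix.mul_assoc]
      exact le_add_of_nonneg_right (PosSemidef.conj hQ _).trace_nonneg
  have hQ0 : Tendsto (fun j => F ^ j * CFC.sqrt Q) atTop (𝓝 0) := by
    refine tendsto_zero_of_trace_mul_transpose (squeeze_zero (fun j => ?_) (fun j => ?_) htr)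
    · simpa [conjTranspose_eq_transpose_of_trivial] using
        (posSemidef_self_mul_conjTranspose (F ^ j * CFC.sqrt Q)).trace_nonneg
    · rw [hsplit, transpose_mul, Matrix.mul_assoc, ← Matrix.mul_assoc (CFC.sqrt Q),
        sqrt_mul_sqrt hQ, ← Matrix.mul_assoc]
      exact le_add_of_nonneg_left (PosSemidef.conj hR.posSemidef _).trace_nonneg
  have hsR : IsUnit (CFC.sqrt R).det := by
    have h1 := congrArg Matrix.det (sqrt_mul_sqrt hR.posSemidef)
    rw [det_mul, det_transpose] at h1
    refine isUnit_iff_ne_zero.2 fun h => hR.det_pos.ne' ?_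
    rw [← h1, h, mul_zero]
  have hL0 : Tendsto (fun j => F ^ j * L) atTop (𝓝 0) := by
    have h1 := ((continuous_id.matrix_mul (continuous_const (y := (CFC.sqrt R)⁻¹))).tendsto
      (0 : Matrix (Fin d) (Fin p) ℝ)).comp hLR
    simp only [id_eq, Matrix.zero_mul] at h1
    refine h1.congr fun j => ?_
    simp only [Function.comp_apply]
    rw [Matrix.mul_assoc, mul_nonsing_inv _ hsR, Matrix.mul_one]
  obtain ⟨G, hG⟩ := hst
  -- Write `F = (A + CFC.sqrt Q * G) + (L * C - CFC.sqrt Q * G)`: the powers of `F` follow a stable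
  -- recursion whose input has just been shown to vanish.
  refine tendsto_zero_of_stable_recursion hG
    (U := fun j => F ^ j * L * C - F ^ j * CFC.sqrt Q * G) (fun j => ?_) ?_
  · rw [pow_succ, hF]
    simp only [Matrix.mul_add, Matrix.mul_assoc]
    abel
  · have h1 := ((continuous_id.matrix_mul (continuous_const (y := C))).tendsto
      (0 : Matrix (Fin d) (Fin p) ℝ)).comp hL0
    have h2 := ((continuous_id.matrix_mul (continuous_const (y := G))).tendsto
      (0 : Matrix (Fin d) (Fin d) ℝ)).comp hQ0
    simpa using h1.sub h2

/-- Convergence of the Riccati recursion from every initial covariance. -/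
theorem exists_riccati_limit (hR : R.PosDef) (hQ : Q.PosSemidef) (hdet : Detectable A C)
    (hst : Stabilizable A (CFC.sqrt Q)) :
    ∃ P : Matrix (Fin d) (Fin d) ℝ, P.PosSemidef ∧ riccati A C Q R P = P ∧
      ∀ X : Matrix (Fin d) (Fin d) ℝ, X.PosSemidef →
        Tendsto (fun k => (riccati A C Q R)^[k] X) atTop (𝓝 P) := by
  have hZ := riccati_iterate_posSemidef (A := A) (C := C) (X := 0) hR hQ PosSemidef.zero
  obtain ⟨L₀, hL₀⟩ := hdet
  obtain ⟨K, hK⟩ := exists_trace_lyap_iterate_le hL₀ (josephNoise_posSemidef hR hQ L₀)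
    (PosSemidef.zero (n := Fin d))
  -- From zero the iterates increase; the stabilizing gain `L₀`, being suboptimal, bounds them.
  obtain ⟨P, hP⟩ := exists_tendsto_of_monotone hZ (fun k => by
    rw [Function.iterate_succ_apply]
    refine riccati_iterate_mono hR hQ PosSemidef.zero
      (riccati_posSemidef hR hQ PosSemidef.zero) ?_ k
    rw [sub_zero]
    exact riccati_posSemidef hR hQ PosSemidef.zero) (K := K) fun k => by
      have h1 := (riccati_iterate_le_lyap (A := A) (C := C) (Q := Q) (X := 0) hR hQ
        PosSemidef.zero L₀ k).trace_nonneg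
      rw [trace_sub] at h1
      linarith [hK k]
  have hPp := posSemidef_of_tendsto hZ hP
  have hfix : riccati A C Q R P = P := by
    have h1 := (continuousAt_riccati (A := A) (C := C) (Q := Q) hR hPp).tendsto.comp hP
    refine tendsto_nhds_unique h1 (((tendsto_add_atTop_iff_nat 1).2 hP).congr fun k => ?_)
    rw [Function.iterate_succ_apply']
    rfl
  refine ⟨P, hPp, hfix, fun X hX => ?_⟩
  obtain ⟨L, hL⟩ := exists_gain A C Q hR hPp
  rw [hfix] at hL
  have hF := tendsto_closedLoop_pow hR hQ hPp hst hL
  have hY : Tendsto (fun k => (lyap (A + L * C) (L * R * Lᵀ + Q))^[k] X) atTop (𝓝 P) := by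
    have h1 : Continuous fun G : Matrix (Fin d) (Fin d) ℝ => G * (X - P) * Gᵀ + P :=
      ((continuous_id.matrix_mul continuous_const).matrix_mul
        continuous_id.matrix_transpose).add continuous_const
    have h2 := (h1.tendsto 0).comp hF
    simp only [Matrix.zero_mul, zero_add] at h2
    refine h2.congr fun k => ?_
    have h3 := Function.iterate_fixed hL.symm k
    rw [lyap_iterate] at h3 ⊢
    simp only [Function.comp_apply, Matrix.mul_sub, Matrix.sub_mul]
    nth_rewrite 2 [← h3]
    abel
  -- The iterates from `X` lie above those from `0` and below those with the constant optimal gain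
  -- of `P`; both bounds tend to `P`.
  refine tendsto_of_squeeze
    (fun k => PosSemidef.isSymm' (riccati_iterate_posSemidef hR hQ hX k)) (fun k => ?_)
    (fun k => riccati_iterate_le_lyap hR hQ hX L k) (PosSemidef.isSymm' hPp) hP hY
  exact riccati_iterate_mono hR hQ PosSemidef.zero hX (by rwa [sub_zero]) k

end Riccati

/-! ### Estimation costs -/

theorem lyap_iterate_succ_sub_posSemidef {d : ℕ} {A Q X : Matrix (Fin d) (Fin d) ℝ}
    (h : (lyap A Q X - X).PosSemidef) (t : ℕ) :
    ((lyap A Q)^[t + 1] X - (lyap A Q)^[t] X).PosSemidef := by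
  induction t with
  | zero => exact h
  | succ t ih =>
    rw [Function.iterate_succ_apply' _ t] at ih
    rw [Function.iterate_succ_apply' _ (t + 1), Function.iterate_succ_apply' _ t, lyap_sub]
    exact PosSemidef.conj ih _

namespace Network

variable {n : ℕ} (N : Network n)

theorem localCov_eq (i : Fin n) (k : ℕ) : N.localCov i k =
    measUpdate (N.C i) (N.R i) ((riccati (N.A i) (N.C i) (N.Q i) (N.R i))^[k] (N.S i)) := by
  induction k with
  | zero => rfl
  | succ k ih =>
    rw [Function.iterate_succ_apply', riccati, ← ih]
    rfl

/-- The limit `P` of the a priori covariances equals `h(P̄)`, and `P̄` is its measurement update,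
which only decreases it. The order `P̄ ≤ h(P̄)` makes the costs increase with age. -/
theorem steadyCov_spec (i : Fin n) : (N.steadyCov i).PosSemidef ∧
    (lyap (N.A i) (N.Q i) (N.steadyCov i) - N.steadyCov i).PosSemidef := by
  obtain ⟨P, hP, hfix, hlim⟩ := exists_riccati_limit (N.posDef_R i) (N.posSemidef_Q i)
    (N.detectable i) (N.stabilizable i)
  have h1 : N.steadyCov i = measUpdate (N.C i) (N.R i) P := by
    refine Tendsto.limUnder_eq ?_
    refine ((continuousAt_measUpdate (N.posDef_R i) hP).tendsto.comp
      (hlim _ (N.posSemidef_S i))).congr fun k => ?_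
    rw [localCov_eq]
    rfl
  have h2 : lyap (N.A i) (N.Q i) (measUpdate (N.C i) (N.R i) P) = P := hfix
  rw [h1, h2, ← riccati_one]
  refine ⟨riccati_posSemidef (N.posDef_R i) Matrix.PosSemidef.zero hP, ?_⟩
  -- Ignoring the measurement is the gain `0`, which is no better than the optimal one.
  have h3 := riccati_le_joseph (A := 1) (C := N.C i) (Q := 0) (N.posDef_R i) hP 0
  simpa [lyap] using h3

theorem lyap_iterate_steadyCov_posSemidef (i : Fin n) (t : ℕ) :
    ((lyap (N.A i) (N.Q i))^[t] (N.steadyCov i)).PosSemidef :=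
  lyap_iterate_posSemidef (N.posSemidef_Q i) (N.steadyCov_spec i).1 t

theorem estCost_nonneg (i : Fin n) (t : ℕ) : 0 ≤ N.estCost i t :=
  (N.lyap_iterate_steadyCov_posSemidef i t).trace_nonneg

theorem estCost_mono (i : Fin n) : Monotone (N.estCost i) := by
  refine monotone_nat_of_le_succ fun t => ?_
  have h1 := (lyap_iterate_succ_sub_posSemidef (N.steadyCov_spec i).2 t).trace_nonneg
  rw [Matrix.trace_sub] at h1
  exact sub_nonneg.1 h1

theorem exists_estCost_succ_le (i : Fin n) :
    ∃ C, ∀ t, N.estCost i (t + 1) ≤ C * (N.estCost i t + 1) := by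
  set b := ∑ j, ∑ k, |N.A i j k| with hb
  have hA : ∀ j k, |N.A i j k| ≤ b := fun j k =>
    (Finset.single_le_sum (f := fun k => |N.A i j k|) (fun _ _ => abs_nonneg _)
      (Finset.mem_univ k)).trans (Finset.single_le_sum (f := fun j => ∑ k, |N.A i j k|)
        (fun _ _ => Finset.sum_nonneg fun _ _ => abs_nonneg _) (Finset.mem_univ j))
  refine ⟨N.dimX i * N.dimX i * N.dimX i * b ^ 2 + (N.Q i).trace, fun t => ?_⟩
  have h1 := PosSemidef.trace_conj_le (N.lyap_iterate_steadyCov_posSemidef i t) hA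
  have h2 := (N.posSemidef_Q i).trace_nonneg
  have h3 : 0 ≤ (N.dimX i * N.dimX i * N.dimX i * b ^ 2 : ℝ) := by positivity
  have h4 := N.estCost_nonneg i t
  rw [estCost] at h4 ⊢
  rw [Function.iterate_succ_apply', lyap, Matrix.trace_add, estCost]
  nlinarith [mul_nonneg h2 h4]

theorem exists_estCost_le_pow (i : Fin n) {γ : ℝ} (h1 : 1 < γ) (hγ : specRad (N.A i) ^ 2 < γ) :
    ∃ C, 0 ≤ C ∧ ∀ t, N.estCost i t ≤ C * γ ^ t := by
  obtain ⟨C, hC0, hC⟩ := exists_trace_pow_conj_le (A := N.A i) (r := Real.sqrt γ)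
    (Real.lt_sqrt_of_sq_lt hγ)
  rw [Real.sq_sqrt (by linarith)] at hC
  have hP := (N.steadyCov_spec i).1
  have hPt := hP.trace_nonneg
  have hQt := (N.posSemidef_Q i).trace_nonneg
  have hγ1 : 0 < γ - 1 := by linarith
  refine ⟨C * (N.steadyCov i).trace + C * (N.Q i).trace / (γ - 1), by positivity, fun t => ?_⟩
  rw [estCost, lyap_iterate, Matrix.trace_add, Matrix.trace_sum, add_mul]
  refine add_le_add (hC _ hP t) ((Finset.sum_le_sum fun j _ => hC _ (N.posSemidef_Q i) j).trans ?_)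
  rw [← Finset.mul_sum, geom_sum_eq h1.ne', div_mul_eq_mul_div, ← mul_div_assoc]
  gcongr
  linarith

theorem exists_estCost_le (i : Fin n) (h : specRad (N.A i) < 1) :
    ∃ K, ∀ t, N.estCost i t ≤ K :=
  exists_trace_lyap_iterate_le h (N.posSemidef_Q i) (N.steadyCov_spec i).1

/-! ### Groups of processes -/

/-- Every pair of members of the group satisfies the growth condition. -/
def Compatible (G : Finset (Fin n)) : Prop :=
  ∀ i ∈ G, ∀ j ∈ G, specRad (N.A i) ^ 2 * (1 - N.lam j) < 1

variable {N}

theorem Fits.compatible {G : Finset (Fin n)} {i : Fin n} (h : N.Fits G i) :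
    N.Compatible (insert i G) := fun a ha b hb => by
  refine lt_of_le_of_lt (mul_le_mul (Finset.le_sup' (fun i' => specRad (N.A i') ^ 2) ha)
    (Finset.le_sup' (fun j' => 1 - N.lam j') hb) (by linarith [N.lam_le_one b]) ?_) h
  exact (sq_nonneg _).trans (Finset.le_sup' (fun i' => specRad (N.A i') ^ 2) ha)

theorem compatible_of_mem_place (hN : N.NecessaryCondition) (i : Fin n)
    {Gs : List (Finset (Fin n))} (h : ∀ G ∈ Gs, N.Compatible G) :
    ∀ G ∈ N.place i Gs, N.Compatible G := by
  induction Gs with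
  | nil =>
    intro G hG
    rw [place, List.mem_singleton] at hG
    subst hG
    intro a ha b hb
    rw [Finset.mem_singleton] at ha hb
    subst ha hb
    -- A new group is opened without a test; the standing condition makes it compatible.
    exact hN b
  | cons H Gs ih =>
    rw [List.forall_mem_cons] at h
    rw [place]
    split_ifs with hf
    · exact List.forall_mem_cons.2 ⟨hf.compatible, h.2⟩
    · exact List.forall_mem_cons.2 ⟨h.1, ih h.2⟩

theorem exists_mem_place (i : Fin n) (Gs : List (Finset (Fin n))) {j : Fin n}
    (h : j = i ∨ ∃ G ∈ Gs, j ∈ G) : ∃ G ∈ N.place i Gs, j ∈ G := by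
  induction Gs with
  | nil => simpa [place] using h
  | cons H Gs ih =>
    rw [place]
    split_ifs with hf
    · simp only [List.mem_cons, exists_eq_or_imp, Finset.mem_insert] at h ⊢
      tauto
    · simp only [List.mem_cons, exists_eq_or_imp] at h ⊢
      rcases h with h | h | h
      · exact Or.inr (ih (Or.inl h))
      · exact Or.inl h
      · exact Or.inr (ih (Or.inr h))

theorem groups_spec (hN : N.NecessaryCondition) (Gu : List (Fin n)) :
    (∀ G ∈ N.groups Gu, N.Compatible G) ∧ ∀ i ∈ Gu, ∃ G ∈ N.groups Gu, i ∈ G := by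
  induction Gu using List.reverseRecOn with
  | nil => simp [groups]
  | append_singleton Gu i ih =>
    have h : N.groups (Gu ++ [i]) = N.place i (N.groups Gu) := by
      simp [groups, List.foldl_append]
    rw [h]
    refine ⟨compatible_of_mem_place hN i ih.1, fun j hj => exists_mem_place i _ ?_⟩
    rw [List.mem_append, List.mem_singleton] at hj
    exact hj.symm.imp_right (ih.2 j)

/-- An assignment of the unstable processes to channels. -/
theorem exists_assignment {m : ℕ} (hN : N.NecessaryCondition) {Gu : List (Fin n)}
    (hGu : N.EnumeratesUnstable Gu) (hm : N.numGroups Gu ≤ m) :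
    ∃ g : Fin n → ℕ, (∀ i, 1 ≤ specRad (N.A i) → g i < m) ∧
      ∀ i j, 1 ≤ specRad (N.A i) → 1 ≤ specRad (N.A j) → g i = g j →
        specRad (N.A i) ^ 2 * (1 - N.lam j) < 1 := by
  obtain ⟨h1, h2⟩ := groups_spec hN Gu
  have h3 : ∀ i, ∃ k, 1 ≤ specRad (N.A i) → ∃ h : k < (N.groups Gu).length,
      i ∈ (N.groups Gu)[k] := fun i => by
    by_cases hi : 1 ≤ specRad (N.A i)
    · obtain ⟨G, hG, hiG⟩ := h2 i ((hGu.2 i).2 hi)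
      obtain ⟨k, hk, rfl⟩ := List.getElem_of_mem hG
      exact ⟨k, fun _ => ⟨hk, hiG⟩⟩
    · exact ⟨0, fun h => absurd h hi⟩
  choose g hg using h3
  refine ⟨g, fun i hi => (hg i hi).1.trans_le hm, fun i j hi hj hij => ?_⟩
  obtain ⟨hk, hik⟩ := hg i hi
  obtain ⟨hk', hjk⟩ := hg j hj
  simp only [← hij] at hjk
  exact h1 _ (List.getElem_mem hk) i hik j hjk

end Network

/-! ### The oldest-first policy -/

section Drift

variable {n : ℕ}

/-- The number of other members of the group that are at least as old as `i`. -/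
def ageRank (G : Finset (Fin n)) (s : State n) (i : Fin n) : ℕ :=
  (G.filter fun j => j ≠ i ∧ s i ≤ s j).card

theorem ageRank_le (G : Finset (Fin n)) (s : State n) (i : Fin n) : ageRank G s i ≤ n :=
  (Finset.card_le_univ _).trans_eq (Fintype.card_fin n)

/-- Geometric drift under the policy that serves the oldest member of a group. -/
theorem Network.sum_ageRank_le {m : ℕ} (N : Network n) {G : Finset (Fin n)} {s : State n}
    {a : Action n m} {l i : Fin n} (hl : l ∈ G) (hi : i ∈ G) (hal : a.1 l = true)
    (ha : ∀ j ∈ G, j ≠ l → a.1 j = false) (hmax : ∀ j ∈ G, s j ≤ s l) {κ γ q : ℝ} (hκ : 1 ≤ κ)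
    (hγ : 1 ≤ γ) (hq : γ * (1 - N.lam l + 1 / κ) ≤ q) :
    ∑ ω, N.noiseProb ω * (κ ^ ageRank G (next s a ω) i * γ ^ next s a ω i) ≤
      q * (κ ^ ageRank G s i * γ ^ s i) + κ ^ n := by
  set T := κ ^ ageRank G s i * γ ^ s i with hT
  have hκ0 : 0 < κ := by linarith
  have hT0 : 0 ≤ T := by positivity
  -- After a failure all members age together, so the ranks stay and the weight grows by `γ`.
  have hfail : ∀ ω, ω l = false → ∀ j ∈ G, next s a ω j = s j + 1 := fun ω hω j hj => by
    by_cases h : j = l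
    · subst h; simp [next, hω]
    · simp [next, ha j hj h]
  have hrank_fail : ∀ ω, ω l = false → ageRank G (next s a ω) i = ageRank G s i := fun ω hω => by
    refine congrArg Finset.card (Finset.filter_congr fun j hj => ?_)
    rw [hfail ω hω j hj, hfail ω hω i hi]
    simp
  have h0 : ∀ ω, ω l = false →
      κ ^ ageRank G (next s a ω) i * γ ^ next s a ω i = γ * T := fun ω hω => by
    rw [hrank_fail ω hω, hfail ω hω i hi, hT, pow_succ]
    ring
  have hlam := N.lam_nonneg l
  have hlam1 := N.lam_le_one l
  have hκn : 0 ≤ κ ^ n := by positivity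
  have hsum : ∀ φ : Bool → ℝ, (∀ ω : Fin n → Bool,
      κ ^ ageRank G (next s a ω) i * γ ^ next s a ω i ≤ φ (ω l)) →
      ∑ ω, N.noiseProb ω * (κ ^ ageRank G (next s a ω) i * γ ^ next s a ω i) ≤
        N.lam l * φ true + (1 - N.lam l) * φ false := fun φ h => by
    rw [← N.sum_noise_coord]
    exact Finset.sum_le_sum fun ω _ => mul_le_mul_of_nonneg_left (h ω) (N.noiseProb_nonneg ω)
  have hq' := mul_le_mul_of_nonneg_right hq hT0
  have hκT : 0 ≤ γ * (1 / κ) * T := by positivity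
  by_cases hil : i = l
  · subst hil
    refine (hsum (fun b => if b = true then κ ^ n else γ * T) fun ω => ?_).trans ?_
    · cases hω : ω i
      · simp [h0 ω hω]
      · have : next s a ω i = 0 := by simp [next, hal, hω]
        simp only [this, pow_zero, mul_one, if_true]
        exact pow_le_pow_right₀ hκ (ageRank_le _ _ _)
    · simp only [if_true, Bool.false_eq_true, if_false]
      nlinarith [mul_le_of_le_one_left hκn hlam1]
  · refine (hsum (fun b => if b = true then γ * (1 / κ) * T else γ * T) fun ω => ?_).trans ?_
    · cases hω : ω l
      · simp [h0 ω hω]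
      · have hnext : ∀ j ∈ G, j ≠ l → next s a ω j = s j + 1 := fun j hj h => by
          simp [next, ha j hj h]
        have hnl : next s a ω l = 0 := by simp [next, hal, hω]
        -- The reset member `l` was at least as old as `i` and is now younger, while the other
        -- comparisons are unchanged.
        have hlt : ageRank G (next s a ω) i < ageRank G s i := by
          refine Finset.card_lt_card (Finset.ssubset_iff_of_subset (fun j hj => ?_) |>.2
            ⟨l, ?_, ?_⟩)
          · rw [Finset.mem_filter] at hj ⊢
            refine ⟨hj.1, hj.2.1, ?_⟩
            have h1 := hj.2.2
            by_cases hjl : j = l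
            · subst hjl
              exact hmax i hi
            · rw [hnext i hi hil, hnext j hj.1 hjl] at h1
              omega
          · exact Finset.mem_filter.2 ⟨hl, Ne.symm hil, hmax i hi⟩
          · rw [Finset.mem_filter, hnl, hnext i hi hil]
            omega
        rw [hnext i hi hil, if_pos rfl, hT]
        obtain ⟨r, hr⟩ : ∃ r, ageRank G s i = r + 1 := ⟨ageRank G s i - 1, by omega⟩
        have h1 : κ ^ ageRank G (next s a ω) i ≤ κ ^ r := pow_le_pow_right₀ hκ (by omega)
        calc κ ^ ageRank G (next s a ω) i * γ ^ (s i + 1) ≤ κ ^ r * γ ^ (s i + 1) := by gcongr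
          _ = γ * (1 / κ) * (κ ^ ageRank G s i * γ ^ s i) := by
            rw [hr, pow_succ, pow_succ]
            field_simp
    · simp only [if_true, Bool.false_eq_true, if_false]
      nlinarith [mul_le_of_le_one_left hκT hlam1]

/-- An action that serves, in each class of `g`, one oldest member. -/
theorem exists_oldest_action {m : ℕ} (u : Finset (Fin n)) {g : Fin n → ℕ}
    (hg : ∀ i ∈ u, g i < m) (s : State n) :
    ∃ a : Action n m, ∀ i ∈ u, ∃ l ∈ u, g l = g i ∧ a.1 l = true ∧
      (∀ j ∈ u, g j = g i → j ≠ l → a.1 j = false) ∧ ∀ j ∈ u, g j = g i → s j ≤ s l := by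
  classical
  have h1 : ∀ c, (∃ i ∈ u, g i = c) → ∃ l ∈ u, g l = c ∧ ∀ j ∈ u, g j = c → s j ≤ s l := by
    rintro c ⟨i, hi, hic⟩
    obtain ⟨l, hl, hmax⟩ := Finset.exists_max_image (u.filter fun j => g j = c) s
      ⟨i, Finset.mem_filter.2 ⟨hi, hic⟩⟩
    rw [Finset.mem_filter] at hl
    exact ⟨l, hl.1, hl.2, fun j hj hjc => hmax j (Finset.mem_filter.2 ⟨hj, hjc⟩)⟩
  choose L hLu hLg hLmax using h1
  have hex : ∀ j, j ∈ u → ∃ i ∈ u, g i = g j := fun j hj => ⟨j, hj, rfl⟩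
  set b : Fin n → Bool := fun j => decide (∃ h : j ∈ u, L (g j) (hex j h) = j) with hb
  have hLL : ∀ c c' (h : ∃ i ∈ u, g i = c) (h' : ∃ i ∈ u, g i = c'), c = c' → L c h = L c' h' := by
    rintro c _ h h' rfl
    rfl
  have hcard : ∑ i, (b i).toNat ≤ m := by
    have h2 : ∑ i, (b i).toNat = (Finset.univ.filter fun i => b i = true).card := by
      rw [Finset.card_filter]
      exact Finset.sum_congr rfl fun i _ => by cases b i <;> rfl
    rw [h2]
    -- A selected process is determined by its class, and the classes are numbered below `m`.
    refine (Finset.card_le_card_of_injOn g (t := Finset.range m) (fun i hi => ?_)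
      fun i hi j hj hij => ?_).trans_eq (Finset.card_range m)
    · simp only [hb, Finset.coe_filter, Set.mem_ofPred_eq, decide_eq_true_eq] at hi
      exact Finset.mem_coe.2 (Finset.mem_range.2 (hg i hi.2.1))
    · simp only [hb, Finset.coe_filter, Set.mem_ofPred_eq, decide_eq_true_eq] at hi hj
      obtain ⟨-, hiu, hi⟩ := hi
      obtain ⟨-, hju, hj⟩ := hj
      rw [← hi, ← hj]
      exact hLL _ _ _ _ hij
  refine ⟨⟨b, hcard⟩, fun i hi => ⟨L (g i) (hex i hi), hLu _ _, hLg _ _, ?_, fun j hj hji hjl => ?_,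
    hLmax _ _⟩⟩
  · exact decide_eq_true ⟨hLu _ _, hLL _ _ _ _ (hLg _ _)⟩
  · refine decide_eq_false ?_
    rintro ⟨h, hj'⟩
    exact hjl (hj'.symm.trans (hLL _ _ _ _ hji))

theorem exists_growth_rate {ι : Type*} [Finite ι] {x : ℝ} {μ : ι → ℝ} (h : ∀ j, x * μ j < 1) :
    ∃ γ, x < γ ∧ ∀ j, γ * μ j < 1 := by
  have h1 : ∀ᶠ γ in 𝓝[>] x, ∀ j, γ * μ j < 1 := by
    refine eventually_all.2 fun j => ?_
    have h2 : Tendsto (fun γ => γ * μ j) (𝓝[>] x) (𝓝 (x * μ j)) :=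
      (tendsto_id'.2 nhdsWithin_le_nhds).mul_const _
    exact h2.eventually_lt_const (h j)
  obtain ⟨γ, h2, h3⟩ := (h1.and self_mem_nhdsWithin).exists
  exact ⟨γ, h3, h2⟩

/-- Finitely many strict inequalities leave room for the extra term `γ / κ` of a successful
transmission, and for one common rate `q`. -/
theorem exists_contraction {ι : Type*} [Finite ι] {γ μ : ι → ℝ} (h : ∀ j, γ j * μ j < 1) :
    ∃ κ q : ℝ, 1 ≤ κ ∧ 0 < q ∧ q < 1 ∧ ∀ j, γ j * (μ j + 1 / κ) ≤ q := by
  have h1 : ∀ᶠ κ : ℝ in atTop, ∀ j, γ j * (μ j + 1 / κ) < 1 := by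
    refine eventually_all.2 fun j => ?_
    have h2 : Tendsto (fun κ : ℝ => γ j * (μ j + 1 / κ)) atTop (𝓝 (γ j * (μ j + 0))) := by
      simp only [one_div]
      exact (tendsto_inv_atTop_zero.const_add _).const_mul _
    rw [add_zero] at h2
    exact h2.eventually_lt_const (h j)
  obtain ⟨κ, h2, h3⟩ := (h1.and (eventually_ge_atTop 1)).exists
  have h4 : ∀ᶠ q in 𝓝[<] (1 : ℝ), ∀ j, γ j * (μ j + 1 / κ) ≤ q :=
    eventually_all.2 fun j => (eventually_nhdsWithin_of_eventually_nhds
      (lt_mem_nhds (h2 j))).mono fun q hq => hq.le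
  obtain ⟨q, h5, h6⟩ := (h4.and (Ioo_mem_nhdsLT (zero_lt_one' ℝ))).exists
  exact ⟨κ, q, h3, h6.1, h6.2, h5⟩

theorem Network.exists_isLyapunov {m : ℕ} (N : Network n) (hN : N.NecessaryCondition)
    {Gu : List (Fin n)} (hGu : N.EnumeratesUnstable Gu) (hm : N.numGroups Gu ≤ m) :
    ∃ (W : State n → ℝ) (B : ℝ), (N.toMDP m N.estCost_nonneg).IsLyapunov W B := by
  classical
  obtain ⟨g, hgm, hg⟩ := exists_assignment hN hGu hm
  set u : Finset (Fin n) := Finset.univ.filter fun i => 1 ≤ specRad (N.A i) with hu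
  have hmem : ∀ i, i ∈ u ↔ 1 ≤ specRad (N.A i) := fun i => by simp [hu]
  -- The rate exceeds the growth of the cost of `i` but still satisfies the group condition with
  -- every member. Stable processes get a dummy rate, harmless because their coefficient `D` is
  -- zero.
  have hγ : ∀ i, ∃ γ : ℝ, i ∈ u → specRad (N.A i) ^ 2 < γ ∧
      ∀ j ∈ u, g j = g i → γ * (1 - N.lam j) < 1 := fun i => by
    by_cases hi : i ∈ u
    · obtain ⟨γ, h1, h2⟩ := exists_growth_rate (ι := {j // j ∈ u ∧ g j = g i})
        (x := specRad (N.A i) ^ 2) (μ := fun j => 1 - N.lam j.1)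
        fun j => hg i j.1 ((hmem i).1 hi) ((hmem j.1).1 j.2.1) j.2.2.symm
      exact ⟨γ, fun _ => ⟨h1, fun j hj hji => h2 ⟨j, hj, hji⟩⟩⟩
    · exact ⟨0, fun h => absurd h hi⟩
  choose γ hγ using hγ
  have hγ1 : ∀ i ∈ u, 1 < γ i := fun i hi => by
    nlinarith [(hγ i hi).1, (hmem i).1 hi]
  obtain ⟨κ, q, hκ, hq0, hq1, hq⟩ := exists_contraction
    (ι := {p : Fin n × Fin n // p.1 ∈ u ∧ p.2 ∈ u ∧ g p.2 = g p.1})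
    (γ := fun p => γ p.1.1) (μ := fun p => 1 - N.lam p.1.2)
    fun p => (hγ p.1.1 p.2.1).2 p.1.2 p.2.2.1 p.2.2.2
  have hDK : ∀ i, ∃ D K : ℝ, 0 ≤ D ∧ 0 ≤ K ∧ (i ∉ u → D = 0) ∧
      ∀ t, N.estCost i t ≤ K + D * γ i ^ t := fun i => by
    by_cases hi : i ∈ u
    · obtain ⟨D, hD, h⟩ := N.exists_estCost_le_pow i (hγ1 i hi) (hγ i hi).1
      exact ⟨D, 0, hD, le_rfl, fun h => absurd hi h, fun t => by simpa using h t⟩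
    · obtain ⟨K, hK⟩ := N.exists_estCost_le i (not_le.1 fun h => hi ((hmem i).2 h))
      exact ⟨0, K, le_rfl, (N.estCost_nonneg i 0).trans (hK 0), fun _ => rfl,
        fun t => by simpa using hK t⟩
  choose D K hD hK hDu hDK using hDK
  set G : Fin n → Finset (Fin n) := fun i => u.filter fun j => g j = g i with hG
  set w : Fin n → State n → ℝ := fun i s => κ ^ ageRank (G i) s i * γ i ^ s i with hw
  have hκ0 : 0 < κ := by linarith
  have h1q : 0 < 1 - q := by linarith
  have hDw : ∀ i s, 0 ≤ D i / (1 - q) * w i s := fun i s => by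
    by_cases hi : i ∈ u
    · have := hγ1 i hi
      have := hD i
      simp only [hw]
      positivity
    · simp [hDu i hi]
  have hest : ∀ i (s : State n), N.estCost i (s i) ≤ K i + D i * w i s := fun i s => by
    refine (hDK i (s i)).trans ?_
    by_cases hi : i ∈ u
    · have h1 := hγ1 i hi
      have h2 : 1 * γ i ^ s i ≤ w i s :=
        mul_le_mul_of_nonneg_right (one_le_pow₀ hκ) (by positivity)
      rw [one_mul] at h2
      have := mul_le_mul_of_nonneg_left h2 (hD i)
      linarith
    · simp [hDu i hi]
  -- The factor `1 / (1 - q)` lets the contraction pay for `D i * w i s`. In `B`, one `N.costShift`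
  -- is the shift of the cost and the other bounds the transmission costs.
  refine ⟨fun s => ∑ i, D i / (1 - q) * w i s,
    ∑ i, (K i + D i / (1 - q) * κ ^ n) + 2 * N.costShift, ?_, fun s =>
      Finset.sum_nonneg fun i _ => hDw i s, fun s => ?_⟩
  · have h1 : 0 ≤ N.costShift := Finset.sum_nonneg fun _ _ => abs_nonneg _
    have h2 : 0 ≤ ∑ i, (K i + D i / (1 - q) * κ ^ n) := Finset.sum_nonneg fun i _ => by
      have := hD i
      have := hK i
      positivity
    linarith
  · obtain ⟨a, ha⟩ := exists_oldest_action u (fun i hi => hgm i ((hmem i).1 hi)) s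
    refine ⟨a, ?_⟩
    have hdrift : ∀ i, D i / (1 - q) * ∑ ω, N.noiseProb ω * w i (next s a ω) ≤
        D i / (1 - q) * (q * w i s + κ ^ n) := fun i => by
      by_cases hi : i ∈ u
      · obtain ⟨l, hl, hli, hal, ha', hmax⟩ := ha i hi
        refine mul_le_mul_of_nonneg_left ?_ (div_nonneg (hD i) h1q.le)
        refine N.sum_ageRank_le (G := G i) (l := l) (Finset.mem_filter.2 ⟨hl, hli⟩)
          (Finset.mem_filter.2 ⟨hi, rfl⟩) hal (fun j hj hjl => ?_) (fun j hj => ?_) hκ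
          (hγ1 i hi).le (hq ⟨(i, l), hi, hl, hli⟩)
        · rw [Finset.mem_filter] at hj
          exact ha' j hj.1 hj.2 hjl
        · rw [Finset.mem_filter] at hj
          exact hmax j hj.1 hj.2
      · simp [hDu i hi]
    have hnext : (N.toMDP m N.estCost_nonneg).nextExp s a (fun s => ∑ i, D i / (1 - q) * w i s) =
        ∑ i, D i / (1 - q) * ∑ ω, N.noiseProb ω * w i (next s a ω) := by
      simp only [NoiseMDP.nextExp, toMDP, Finset.mul_sum]
      rw [Finset.sum_comm]
      exact Finset.sum_congr rfl fun i _ => Finset.sum_congr rfl fun ω _ => by ring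
    have hcost : N.cost s a + N.costShift ≤ ∑ i, (K i + D i * w i s) + 2 * N.costShift := by
      rw [two_mul, ← add_assoc]
      refine add_le_add_left ?_ _
      rw [cost, costShift, ← Finset.sum_add_distrib]
      refine Finset.sum_le_sum fun i _ => add_le_add (hest i s) ?_
      cases a.1 i
      · simp
      · simpa using le_abs_self (N.cc i)
    have hterm : ∀ i, K i + D i * w i s + D i / (1 - q) * (q * w i s + κ ^ n) =
        D i / (1 - q) * w i s + (K i + D i / (1 - q) * κ ^ n) := fun i => by
      field_simp
      ring
    have hsum := Finset.sum_le_sum fun i (_ : i ∈ Finset.univ) => hdrift i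
    have htot : ∑ i, (K i + D i * w i s) + ∑ i, D i / (1 - q) * (q * w i s + κ ^ n) =
        ∑ i, D i / (1 - q) * w i s + ∑ i, (K i + D i / (1 - q) * κ ^ n) := by
      rw [← Finset.sum_add_distrib, ← Finset.sum_add_distrib]
      exact Finset.sum_congr rfl fun i _ => hterm i
    rw [hnext]
    simp only [toMDP]
    linarith

end Drift

end SensorScheduling

theorem theorem1 {n m : ℕ} (N : SensorScheduling.Network n) (hN : N.NecessaryCondition)
    (Gu : List (Fin n)) (hGu : N.EnumeratesUnstable Gu) (hm : N.numGroups Gu ≤ m) :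
    ∃ (J : ℝ) (V : SensorScheduling.State n → ℝ)
      (f : SensorScheduling.State n → SensorScheduling.Action n m),
      (∀ s, IsLeast (Set.range fun a : SensorScheduling.Action n m => N.bellmanValue V s a)
        (J + V s)) ∧
      (∀ s, J + V s = N.bellmanValue V s (f s)) ∧
      (∀ s₀ : SensorScheduling.State n,
        Tendsto (fun T => N.timeAverage (SensorScheduling.stationaryPolicy f) s₀ T) atTop (𝓝 J) ∧
        N.averageCost (SensorScheduling.stationaryPolicy f) s₀ = (J : EReal) ∧
        IsLeast (Set.range fun π : SensorScheduling.Policy n m => N.averageCost π s₀)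
          (J : EReal)) := by
  obtain ⟨W, B, hW⟩ := N.exists_isLyapunov hN hGu hm
  exact SensorScheduling.Network.exists_optimal N.estCost_mono N.exists_estCost_succ_le hW
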